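/- Conventions. A tableau is a filling of a Ferrers diagram (rows listed from bottom to top) with positive integers, weakly increasing along rows and strictly increasing up columns; its word is read row by row from top to bottom, left to right. $P(w)$ is the Robinson–Schensted insertion tableau of a word $w$, that is, the unique tableau Knuth equivalent to $w$. $\sigma_i$ is the Lascoux–Schützenberger action of the elementary transposition $(i,i+1)$ on words, and hence on tableaux. The charge of a word whose evaluation is a partition is the usual (Lascoux–Schützenberger) charge, normalized so that a tableau of shape and evaluation $\mu$ has charge $0$; for any other evaluation, first permute the evaluation to a partition by the $\sigma_i$. Schur functions $S_\mu=S_\mu[X]$ have coefficients in $\mathbb Q(q,t)$; $\geq$ is dominance order. Let $k$ be a non-negative integer; a partition $\lambda$ is $k$-bounded if all its parts are at most $k$. A hook is a partition $(m,1^r)$ with $m\ge 1$, $r\ge 0$, and a $k$-generalized hook is a partition $(k,\dots,k,\rho_1,\rho_2,\dots)$, with any number ($\geq 0$) of leading parts $k$, where $(\rho_1,\rho_2,\dots)$ is a hook. Super atoms. For a tableau $T$ with largest letter $m$, let $\mathbb B_r(T)=\sigma_1\cdots\sigma_m\mathbb R_r T$, where $\mathbb R_r$ adds a horizontal $r$-strip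 of letters $m+1$ to $T$ in all possible ways. For a partition $\nu$ contained in the shape of $T$, let $T_\nu$ be the subtableau of shape $\nu$, let $T_1$ be the part of $T\setminus T_\nu$ in the first $\ell(\nu)$ rows and $T_2$ the part above; the restricted katabolism $\overline{\mathbb K}_\nu(T)$ is $P(w(T_1)w(T_2))$ if $T_\nu$ has evaluation $(0^j,\nu_1,\nu_2,\dots)$ for some $j\geq0$, and is $0$ otherwise (also when $\nu\not\subseteq\mathrm{shape}(T)$). The $k$-split $\lambda^{\to k}=(\lambda^{(1)},\dots,\lambda^{(s)})$ of a $k$-bounded partition cuts $\lambda$ into consecutive partitions with main hook-length $\lambda^{(i)}_1+\ell(\lambda^{(i)})-1=k$ for $i<s$ and at most $k$ for $i=s$. The filter $\mathbb P_{\lambda^{\to k}}$ keeps the tableaux $T$ for which $\overline{\mathbb K}_{\lambda^{(s)}}\cdots\overline{\mathbb K}_{\lambda^{(1)}}(T)$ is the empty tableau and kills all others. Then $\mathbb A^{(k)}_\emptyset$ consists of the empty tableau, $$\mathbb A^{(k)}_\lambda=\mathbb P_{\lambda^{\to k}}\,\mathbb B_{\lambda_1}\bigl(\mathbb A^{(k)}_{(\lambda_2,\lambda_3,\dots)}\bigr),\qquad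 A^{(k)}_\lambda[X;t]=\sum_{T\in\mathbb A^{(k)}_\lambda}t^{\mathrm{charge}(T)}S_{\mathrm{shape}(T)}[X].$$ Copies. If a tableau $T$ has word $xw$ with $x$ not its smallest letter, its cyclage is $P(wx)$; if it has word $wx$ with $x$ not its smallest letter, its cocyclage is $P(xw)$. On a collection of tableaux of the same evaluation let $<_{cc}$ be the partial order generated by $T<_{cc}T'$ whenever both lie in the collection and, after permuting the evaluation to a partition by the $\sigma_i$, $T'$ is the cyclage of $T$ or $T$ is the cocyclage of $T'$. For a tableau $T$ of $k$-bounded shape, a copy $\mathbb A^{(k)}_T$ of $\mathbb A^{(k)}_{\mathrm{shape}(T)}$ is a collection of tableaux of the same evaluation containing $T$, in which $T$ has minimal charge, and whose Hasse diagram for $<_{cc}$, with vertices labelled by shapes, is that of $\mathbb A^{(k)}_{\mathrm{shape}(T)}$ (i.e. there is a shape-preserving isomorphism of posets). Theorem. Let $\lambda$ be a $k$-bounded partition that is not a $k$-generalized hook. (1) If $T$ is a tableau of shape $\lambda$, then no copy $\mathbb A^{(k)}_T$ contains a tableau whose shape is a hook. (2) There are polynomials $v_\mu(t)\in\mathbb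 N[t]$, for partitions $\mu>\lambda$ of $|\lambda|$, such that $$A^{(k)}_\lambda[X;t]=S_\lambda[X]+\sum_{\mu>\lambda}v_\mu(t)\,S_\mu[X],$$ and $v_\mu(t)=0$ for every hook $\mu$. Moreover, in every finite expansion $A^{(k)}_\lambda[X;t]=\sum_\mu c_\mu S_\mu[X]$ with $c_\mu\in\mathbb Q(q,t)$, one has $c_\mu=0$ for every hook $\mu$. -/

import Mathlib

open scoped Polynomial

namespace TableauAtoms

/-! ### Partitions, words, tableaux -/

/-- A partition, as the weakly decreasing list of its (positive) parts. -/
def IsPartition (l : List ℕ) : Prop :=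
  l.Pairwise (fun a b => b ≤ a) ∧ ∀ p ∈ l, 0 < p

/-- The type of all partitions. -/
abbrev Ptn : Type := {l : List ℕ // IsPartition l}

/-- Strict dominance order `lam < mu` on partitions of the same integer. -/
def DominanceLT (lam mu : List ℕ) : Prop :=
  lam.sum = mu.sum ∧ (∀ i, (lam.take i).sum ≤ (mu.take i).sum) ∧ lam ≠ mu

/-- A hook `(m, 1^r)` with `m ≥ 1`. -/
def IsHook (mu : List ℕ) : Prop :=
  ∃ m r : ℕ, 0 < m ∧ mu = m :: List.replicate r 1

/-- A `k`-generalized hook `(k, …, k, ρ₁, ρ₂, …)` with `ρ` a hook. -/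
def IsGeneralizedHook (k : ℕ) (lam : List ℕ) : Prop :=
  ∃ (n : ℕ) (rho : List ℕ), IsHook rho ∧ lam = List.replicate n k ++ rho

/-- Words in the letters `1, 2, 3, …`. -/
abbrev Word : Type := List ℕ

/-- The largest letter of a word (`0` for the empty word). -/
def maxLetter (w : Word) : ℕ := w.foldr max 0

/-- The evaluation `(ρ₁, …, ρ_m)`: `ρ_i` is the number of letters `i`, and `m` is the
largest letter. -/
def evaluation (w : Word) : List ℕ :=
  (List.range' 1 (maxLetter w)).map (fun i => w.count i)

/-- A filling of a Ferrers diagram, as the list of its rows from bottom to top. -/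
abbrev Filling : Type := List (List ℕ)

/-- Row lengths, from bottom to top. -/
def shape (T : Filling) : List ℕ := T.map List.length

/-- The reading word: rows from top to bottom, each read from left to right. -/
def word (T : Filling) : Word := T.reverse.flatten

/-- Semistandard tableaux: positive entries, weakly increasing in rows and strictly increasing
up the columns; the rows are nonempty, so that the empty tableau is `[]`. -/
def IsTableau (T : Filling) : Prop :=
  (∀ r ∈ T, r ≠ [] ∧ r.Pairwise (· ≤ ·) ∧ ∀ x ∈ r, 0 < x) ∧
  T.IsChain (fun r s => s.length ≤ r.length ∧ ∀ j < s.length, r.getD j 0 < s.getD j 0)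

/-! ### The Robinson–Schensted tableau of a word -/

/-- Schensted row insertion of a letter. -/
def insertLetter (x : ℕ) : Filling → Filling
  | [] => [[x]]
  | r :: rs =>
    match r.dropWhile (· ≤ x) with
    | [] => (r ++ [x]) :: rs
    | y :: q => (r.takeWhile (· ≤ x) ++ x :: q) :: insertLetter y rs

/-- `P(w)`, the unique tableau Knuth equivalent to `w`, computed by row insertion. -/
def rsTableau (w : Word) : Filling := w.foldl (fun T x => insertLetter x T) []

/-! ### The action of the symmetric group on words and tableaux -/

/-- Number of letters `i` of `w` that stay unpaired when factors `(i+1) i` are successively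
paired off. -/
def unpairedLow (i : ℕ) (w : Word) : ℕ :=
  w.foldr (fun x n => if x = i then n + 1 else if x = i + 1 then n - 1 else n) 0

/-- Number of letters `i+1` of `w` that stay unpaired. -/
def unpairedHigh (i : ℕ) (w : Word) : ℕ :=
  w.foldl (fun n x => if x = i + 1 then n + 1 else if x = i then n - 1 else n) 0

/-- Reads the word from left to right; `n` is the number of letters `i+1` already read which are
paired with a letter `i` not yet read, and `s` is the number of unpaired letters which still have
to become `i`; later unpaired letters become `i+1`. A letter `i+1` is paired exactly if the part
of the word after it has an unpaired `i`. -/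
def sigmaAux (i : ℕ) : ℕ → ℕ → Word → Word
  | _, _, [] => []
  | n, s, x :: w =>
    if x = i then
      if 0 < n then i :: sigmaAux i (n - 1) s w
      else (if 0 < s then i else i + 1) :: sigmaAux i n (s - 1) w
    else if x = i + 1 then
      if 0 < unpairedLow i w then (i + 1) :: sigmaAux i (n + 1) s w
      else (if 0 < s then i else i + 1) :: sigmaAux i n (s - 1) w
    else x :: sigmaAux i n s w

/-- The elementary transposition `σ_i`: the unpaired letters, which form a word
`i^r (i+1)^s`, are replaced by `i^s (i+1)^r`, all other letters are kept. -/
def sigma (i : ℕ) (w : Word) : Word := sigmaAux i 0 (unpairedHigh i w) w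

/-- Applies a length preserving map of words to a tableau through its reading word: the new word
is placed in the same diagram. -/
def onWord (f : Word → Word) (T : Filling) : Filling :=
  ((T.reverse.map List.length).splitLengths (f (word T))).reverse

/-- One pass of `σ_1, σ_2, …`, exchanging neighbouring multiplicities that are out of order. -/
def straightenPass (w : Word) : Word :=
  (List.range' 1 (maxLetter w - 1)).foldl
    (fun u i => if u.count i < u.count (i + 1) then sigma i u else u) w

/-- The word obtained from `w` by permuting its evaluation to a partition through the action of
the symmetric group (by bubble sort). -/
def straighten (w : Word) : Word := straightenPass^[maxLetter w] w

/-! ### Charge -/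

/-- State of the labelling procedure: the unlabelled letters already met since the last passage
of the separator, those still to be met before the next passage, the current label, and the sum
of the labels given so far. -/
structure ChargeState where
  before : List ℕ
  after : List ℕ
  label : ℕ
  total : ℕ

/-- Labels (and removes) the next letter `a`; the label increases when the separator is passed. -/
def chargeStep (s : ChargeState) (a : ℕ) : ChargeState :=
  if a ∈ s.after then
    { before := s.before ++ s.after.takeWhile (· ≠ a)
      after := (s.after.dropWhile (· ≠ a)).tail
      label := s.label
      total := s.total + s.label }
  else if a ∈ s.before then
    { before := s.before.takeWhile (· ≠ a)
      after := (s.before.dropWhile (· ≠ a)).tail ++ s.after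
      label := s.label + 1
      total := s.total + (s.label + 1) }
  else s

/-- One round, labelling a letter `1`, then a letter `2`, and so on, on the circular word `u` read
from the separator on. -/
def chargeRound (u : List ℕ) : ChargeState :=
  (List.range' 1 (maxLetter u)).foldl chargeStep ⟨[], u, 0, 0⟩

/-- The sum of the labels over a given number of rounds. -/
def chargeRounds : ℕ → List ℕ → ℕ
  | 0, _ => 0
  | n + 1, u =>
    (chargeRound u).total + chargeRounds n ((chargeRound u).before ++ (chargeRound u).after)

/-- The charge of a word. If the evaluation is not a partition, it is first permuted to one. The
word is written counterclockwise and read clockwise, hence from right to left; there are as many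
rounds as letters `1`. -/
def charge (w : Word) : ℕ :=
  chargeRounds ((straighten w).count 1) (straighten w).reverse

/-! ### Promotion operators -/

/-- All ways of adding a horizontal strip of `r` letters `x` to the rows `T`, where the lowest row
of the result has length at most `cap`. -/
def addStrip (x : ℕ) : ℕ → Filling → ℕ → Finset Filling
  | cap, [], r => if r = 0 then {[]} else if r ≤ cap then {[List.replicate r x]} else ∅
  | cap, row :: rows, r =>
    ((Finset.range (r + 1)).filter (fun c => row.length + c ≤ cap)).biUnion
      (fun c => (addStrip x row.length rows (r - c)).image
        (fun U => (row ++ List.replicate c x) :: U))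

/-- The promotion operator `B_r = σ_1 ⋯ σ_m R_r` on a tableau with largest letter `m`, where `R_r`
adds a horizontal `r`-strip of letters `m+1` in all possible ways. -/
def promotion (r : ℕ) (T : Filling) : Finset Filling :=
  (addStrip (maxLetter (word T) + 1) ((T.headD []).length + r) T r).image
    (onWord (fun w => (List.range' 1 (maxLetter (word T))).foldr sigma w))

/-! ### Katabolism and filtering operators -/

/-- The `k`-split of a `k`-bounded partition: cut into successive partitions of main hook-length
`λ₁ + ℓ(λ) - 1` equal to `k`, the last one being allowed to have smaller main hook-length. -/
def kSplit (k : ℕ) : List ℕ → List (List ℕ)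
  | [] => []
  | a :: l => (a :: l.take (k - a)) :: kSplit k (l.drop (k - a))
termination_by l => l.length
decreasing_by simp

/-- Containment of the diagram of `lam` in the shape of `T`. -/
def Contained (lam : List ℕ) (T : Filling) : Prop :=
  ∀ i < lam.length, lam.getD i 0 ≤ (shape T).getD i 0

/-- `T_lam`, the subtableau of shape `lam`. -/
def subtableau (lam : List ℕ) (T : Filling) : Filling :=
  List.zipWith (fun row p => row.take p) T lam

open Classical in
/-- `lam`-katabolism; `none` stands for `0`. The two words are those of the part of `T` outside
`T_lam` in the first `ℓ(lam)` rows, and of the part of `T` above these rows. -/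
noncomputable def katabolism (lam : List ℕ) (T : Filling) : Option Filling :=
  if Contained lam T then
    some (rsTableau
      (word (List.zipWith (fun row p => row.drop p) T lam) ++ word (T.drop lam.length)))
  else none

/-- The set `S(lam)` of tableaux of shape `lam` and evaluation `(0^m, lam₁, lam₂, …)`. -/
def InS (lam : List ℕ) (U : Filling) : Prop :=
  IsTableau U ∧ shape U = lam ∧ ∃ m, evaluation (word U) = List.replicate m 0 ++ lam

open Classical in
/-- Restricted `lam`-katabolism. -/
noncomputable def restrictedKatabolism (lam : List ℕ) (T : Filling) : Option Filling :=
  if Contained lam T ∧ InS lam (subtableau lam T) then katabolism lam T else none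

/-- `T` is kept by the filtering operator `P_S`: the successive restricted katabolisms along `S`
send `T` to the empty tableau. -/
def Passes (S : List (List ℕ)) (T : Filling) : Prop :=
  S.foldl (fun o lam => o.bind (restrictedKatabolism lam)) (some T) = some []

/-! ### Super atoms, atoms -/

open Classical in
/-- The super atom of level `k` of a `k`-bounded partition. -/
noncomputable def superAtom (k : ℕ) : List ℕ → Finset Filling
  | [] => {[]}
  | a :: l => ((superAtom k l).biUnion (promotion a)).filter (Passes (kSplit k (a :: l)))

/-- The field `ℚ(q,t)`. -/
abbrev Kqt : Type := FractionRing (MvPolynomial (Fin 2) ℚ)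

/-- The indeterminate `t` of `ℚ(q,t)`. -/
noncomputable def tvar : Kqt := algebraMap (MvPolynomial (Fin 2) ℚ) Kqt (MvPolynomial.X 1)

/-- The Schur function in the variables `x₁, x₂, …` (indexed by `0, 1, …`): the coefficient of a
monomial is the number of tableaux of shape `mu` with the corresponding evaluation. -/
noncomputable def schur (mu : List ℕ) : MvPowerSeries ℕ Kqt :=
  fun m => (Nat.card {T : Filling // IsTableau T ∧ shape T = mu ∧
    ∀ i, (word T).count (i + 1) = m i} : Kqt)

/-- The atom `A_lam^{(k)}[X;t]`. -/
noncomputable def atom (k : ℕ) (lam : List ℕ) : MvPowerSeries ℕ Kqt :=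
  ∑ T ∈ superAtom k lam, tvar ^ charge (word T) • schur (shape T)

/-! ### The cyclage-cocyclage poset and copies of atoms -/

/-- `T'` is the cyclage of `T`: `T = x w` with `x` not the smallest letter, and `T' ≡ w x`. -/
def IsCyclage (T T' : Filling) : Prop :=
  ∃ (x : ℕ) (w : Word), word T = x :: w ∧ (∃ y ∈ word T, y < x) ∧ T' = rsTableau (w ++ [x])

/-- `T'` is the cocyclage of `T`: `T = w x` with `x` not the smallest letter, and `T' ≡ x w`. -/
def IsCocyclage (T T' : Filling) : Prop :=
  ∃ (x : ℕ) (w : Word), word T = w ++ [x] ∧ (∃ y ∈ word T, y < x) ∧ T' = rsTableau (x :: w)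

/-- `T` and `T'` are linked, `T` being the one of smaller charge: after permuting the evaluation
to a partition, `T'` is the cyclage of `T` or `T` is the cocyclage of `T'` (a cyclage raises the
charge by one, a cocyclage lowers it by one). -/
def Linked (T T' : Filling) : Prop :=
  IsCyclage (onWord straighten T) (onWord straighten T') ∨
  IsCocyclage (onWord straighten T') (onWord straighten T)

/-- The order `<_cc` on a collection of tableaux of the same evaluation. -/
def ccLT (C : Set Filling) : Filling → Filling → Prop :=
  Relation.TransGen (fun T T' => T ∈ C ∧ T' ∈ C ∧ Linked T T')

/-- `C` is a copy `A_T^{(k)}` of the super atom of level `k` of `shape T`: a collection of tableaux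
of the same evaluation in which `T` has minimal charge, and whose Hasse diagram for `<_cc`, with
vertices labelled by shapes, is that of the super atom. -/
def IsCopy (k : ℕ) (C : Set Filling) (T : Filling) : Prop :=
  (∀ U ∈ C, IsTableau U ∧ evaluation (word U) = evaluation (word T)) ∧
  (T ∈ C ∧ ∀ U ∈ C, charge (word T) ≤ charge (word U)) ∧
  ∃ e : {U // U ∈ C} ≃ {U // U ∈ superAtom k (shape T)},
    (∀ U, shape (e U).1 = shape U.1) ∧
    ∀ U V, ccLT C U.1 V.1 ↔ ccLT (superAtom k (shape T) : Set Filling) (e U).1 (e V).1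

end TableauAtoms

open TableauAtoms

namespace TableauAtoms

/-! ### Rows as counting functions -/

/-! Hooks are excluded by the filter alone. Let a hook-shaped tableau pass the filter of a nonempty
`k`-bounded partition with first part `a`. If `a < k` and a second part exists, the first block of
the `k`-split has at least two rows; it fits inside a hook only if the second part is at most 1, so
the partition is itself a hook. If `a = k`, the first block is the single row `(k)`. Its katabolism
leaves the rest of the bottom row, which is weakly increasing, followed by the column read
downwards, which is strictly decreasing, and inserting such a word gives a hook again
(`rsTableau_hook`). Induction along the `k`-split shows that the partition is a generalized hook:
`isGeneralizedHook_of_passes`.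

Copies have the same shapes as the super atom, which gives (1).

For the expansion in (2), each `σ_i` preserves tableaux and their shapes (`exists_word_eq_sigma`),
so the members of the super atom are tableaux of content `lam` (`superAtom_spec`). Column strictness
makes their shapes dominate `lam`, with equality only for the superstandard tableau. That tableau
survives promotion and filtering and has charge 0, hence the leading coefficient 1. The last claim
follows from linear independence of Schur functions, by unitriangularity of the Kostka numbers
(`linearIndependent_schur`).

Rows are handled through their counting functions `cntLE`: column strictness becomes a family of
inequalities, and `σ_i` alters a single value per row. -/

/-- The number of entries of `r` that are at most `x`. -/
def cntLE (x : ℕ) (r : List ℕ) : ℕ := r.countP (· ≤ x)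

lemma cntLE_nil (x : ℕ) : cntLE x [] = 0 := rfl

lemma cntLE_append (x : ℕ) (r s : List ℕ) : cntLE x (r ++ s) = cntLE x r + cntLE x s := by
  simp [cntLE]

lemma cntLE_cons (x y : ℕ) (r : List ℕ) :
    cntLE x (y :: r) = cntLE x r + if y ≤ x then 1 else 0 := by
  simp [cntLE, List.countP_cons]

lemma cntLE_replicate (x y n : ℕ) :
    cntLE x (List.replicate n y) = if y ≤ x then n else 0 := by
  simp [cntLE, List.countP_replicate]

lemma cntLE_le_length (x : ℕ) (r : List ℕ) : cntLE x r ≤ r.length := List.countP_le_length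

lemma cntLE_mono {x y : ℕ} (h : x ≤ y) (r : List ℕ) : cntLE x r ≤ cntLE y r :=
  List.countP_mono_left (by simp only [decide_eq_true_eq]; intro a _ ha; omega)

lemma cntLE_eq_zero {x : ℕ} {r : List ℕ} : cntLE x r = 0 ↔ ∀ y ∈ r, x < y := by
  simp [cntLE, List.countP_eq_zero]

lemma cntLE_eq_length {x : ℕ} {r : List ℕ} : cntLE x r = r.length ↔ ∀ y ∈ r, y ≤ x := by
  simp [cntLE, List.countP_eq_length]

lemma cntLE_succ (x : ℕ) (r : List ℕ) : cntLE (x + 1) r = cntLE x r + r.count (x + 1) := by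
  induction r with
  | nil => rfl
  | cons y r ih =>
    rw [cntLE_cons, cntLE_cons, List.count_cons, ih]
    simp only [beq_iff_eq]
    split_ifs <;> omega

lemma getD_le_iff_lt_cntLE {r : List ℕ} (hr : r.Pairwise (· ≤ ·)) (x : ℕ) :
    ∀ j < r.length, (r.getD j 0 ≤ x ↔ j < cntLE x r) := by
  induction r with
  | nil => simp
  | cons y r ih =>
    rw [List.pairwise_cons] at hr
    intro j hj
    rw [cntLE_cons]
    by_cases hy : y ≤ x
    · cases j with
      | zero => simp [hy]
      | succ j =>
        have := ih hr.2 j (by simpa using hj)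
        simp only [List.getD_cons_succ, hy, if_true, this]
        omega
    · have h0 : cntLE x r = 0 := cntLE_eq_zero.2 fun z hz => by have := hr.1 z hz; omega
      simp only [hy, if_false, h0, Nat.add_zero, Nat.not_lt_zero, iff_false, not_le]
      have hm : (y :: r).getD j 0 ∈ y :: r := by
        rw [List.getD_eq_getElem _ _ hj]; exact List.getElem_mem hj
      rcases List.mem_cons.1 hm with h | h
      · omega
      · have := hr.1 _ h; omega

/-- The row `s` may be put on top of the row `r`. -/
def Fits (r s : List ℕ) : Prop := ∀ x, cntLE (x + 1) s ≤ cntLE x r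

lemma Fits.length_le {r s : List ℕ} (h : Fits r s) : s.length ≤ r.length := by
  -- The sum of `s` bounds each of its letters, so at this value the count is the full length.
  have h1 := h (s.sum)
  have h2 : cntLE (s.sum + 1) s = s.length := cntLE_eq_length.2 fun y hy => by
    have := List.single_le_sum (fun _ _ => Nat.zero_le _) y hy; omega
  have h3 := cntLE_le_length s.sum r
  omega

/-- In a sorted row, position `j` holds a letter at most `x` exactly when `j < cntLE x`, so
entrywise comparison and comparison of counts are equivalent. Positivity is a separate hypothesis
because `Fits` says nothing about the letter 0 in `s`. -/
lemma fits_iff {r s : List ℕ} (hr : r.Pairwise (· ≤ ·)) (hs : s.Pairwise (· ≤ ·))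
    (hpos : cntLE 0 s = 0) :
    (s.length ≤ r.length ∧ ∀ j < s.length, r.getD j 0 < s.getD j 0) ↔ Fits r s := by
  constructor
  · rintro ⟨hl, h⟩ x
    by_contra! hc
    have hj : cntLE x r < s.length := hc.trans_le (cntLE_le_length _ _)
    have h1 := (getD_le_iff_lt_cntLE hs (x + 1) _ hj).2 hc
    have h2 := h _ hj
    have h3 := (getD_le_iff_lt_cntLE hr x _ (hj.trans_le hl)).1 (by omega)
    omega
  · intro h
    refine ⟨h.length_le, fun j hj => ?_⟩
    have h0 : ¬ s.getD j 0 ≤ 0 := by rw [getD_le_iff_lt_cntLE hs 0 j hj]; omega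
    obtain ⟨x, hx⟩ : ∃ x, s.getD j 0 = x + 1 := ⟨s.getD j 0 - 1, by omega⟩
    have h1 := (getD_le_iff_lt_cntLE hs (x + 1) j hj).1 hx.le
    have h2 := (getD_le_iff_lt_cntLE hr x j (hj.trans_le h.length_le)).2 (h1.trans_le (h x))
    omega

/-- A nonempty weakly increasing row of positive integers. -/
def IsRow (r : List ℕ) : Prop := r ≠ [] ∧ r.Pairwise (· ≤ ·) ∧ cntLE 0 r = 0

lemma isTableau_iff (T : Filling) : IsTableau T ↔ (∀ r ∈ T, IsRow r) ∧ T.IsChain Fits := by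
  have h1 : (∀ r ∈ T, r ≠ [] ∧ r.Pairwise (· ≤ ·) ∧ ∀ x ∈ r, 0 < x) ↔ ∀ r ∈ T, IsRow r := by
    simp only [IsRow, cntLE_eq_zero]
  rw [IsTableau, h1]
  refine and_congr_right fun h => ?_
  induction T with
  | nil => simp
  | cons r T ih =>
    rw [List.isChain_cons, List.isChain_cons,
      ih (by simp only [IsRow, cntLE_eq_zero]) (fun s hs => h s (by simp [hs]))]
    refine and_congr_left fun _ => forall₂_congr fun s hs => ?_
    have hr := h r (by simp)
    have hs := h s (List.mem_cons_of_mem _ (List.mem_of_mem_head? hs))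
    exact fits_iff hr.2.1 hs.2.1 hs.2.2

lemma isTableau_nil : IsTableau [] := by simp [isTableau_iff]

lemma isTableau_cons {r : List ℕ} {T : Filling} :
    IsTableau (r :: T) ↔ IsRow r ∧ (∀ s ∈ T.head?, Fits r s) ∧ IsTableau T := by
  simp only [isTableau_iff, List.isChain_cons, List.forall_mem_cons]
  tauto

lemma isPartition_shape {T : Filling} (hT : IsTableau T) : IsPartition (shape T) := by
  rw [isTableau_iff] at hT
  constructor
  · have hc : (shape T).IsChain (fun a b => b ≤ a) := by
      rw [shape, List.isChain_map]
      exact hT.2.imp fun _ _ h => h.length_le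
    have : IsTrans ℕ (fun a b => b ≤ a) := ⟨fun _ _ _ h h' => h'.trans h⟩
    exact List.isChain_iff_pairwise.1 hc
  · simp only [shape, List.mem_map]
    rintro _ ⟨r, hr, rfl⟩
    exact List.length_pos_iff.2 (hT.1 r hr).1

/-! ### The action of `σ_i` on the letters of a word -/

lemma count_sigmaAux_of_ne (i j : ℕ) (h1 : j ≠ i) (h2 : j ≠ i + 1) (w : Word) :
    ∀ n s, (sigmaAux i n s w).count j = w.count j := by
  induction w with
  | nil => intro n s; rfl
  | cons x w ih =>
    intro n s
    rw [sigmaAux]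
    split_ifs <;> simp only [List.count_cons, beq_iff_eq, ih] <;> split_ifs <;> omega

lemma count_sigmaAux_add (i : ℕ) (w : Word) : ∀ n s,
    (sigmaAux i n s w).count i + (sigmaAux i n s w).count (i + 1) =
      w.count i + w.count (i + 1) := by
  induction w with
  | nil => intro n s; rfl
  | cons x w ih =>
    intro n s
    rw [sigmaAux]
    split_ifs with h1 h2 h3 h4 h5 h6 <;> simp only [List.count_cons, beq_iff_eq]
    all_goals
      have a0 := ih (n - 1) s
      have a1 := ih n (s - 1)
      have a2 := ih n s
      have a3 := ih (n + 1) s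
      split_ifs <;> omega

/-- The start value `n` stands for letters `i+1` still open before `w`; they absorb unpaired letters
`i` of `w`, whence the truncated difference. At `n = 0` the identity says that the unpaired letters
account for the difference of the two multiplicities. -/
lemma unpairedHigh_aux (i : ℕ) (w : Word) : ∀ n : ℕ,
    w.foldl (fun n x => if x = i + 1 then n + 1 else if x = i then n - 1 else n) n + w.count i =
      w.count (i + 1) + unpairedLow i w + (n - unpairedLow i w) := by
  induction w with
  | nil => intro n; simp [unpairedLow]
  | cons x w ih =>
    intro n
    have hx : unpairedLow i (x :: w) = if x = i then unpairedLow i w + 1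
      else if x = i + 1 then unpairedLow i w - 1 else unpairedLow i w := rfl
    rw [List.foldl_cons, hx]
    have h1 := ih (n + 1)
    have h2 := ih (n - 1)
    have h3 := ih n
    simp only [List.count_cons, beq_iff_eq]
    split_ifs <;> omega

lemma unpairedLow_cons (i x : ℕ) (w : Word) :
    unpairedLow i (x :: w) = if x = i then unpairedLow i w + 1
      else if x = i + 1 then unpairedLow i w - 1 else unpairedLow i w := rfl

lemma unpairedLow_bounds (i : ℕ) (w : Word) :
    unpairedLow i w ≤ w.count i ∧ w.count i ≤ w.count (i + 1) + unpairedLow i w := by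
  induction w with
  | nil => simp [unpairedLow]
  | cons x w ih =>
    rw [unpairedLow_cons]
    simp only [List.count_cons, beq_iff_eq]
    split_ifs <;> omega

/-- Of the unpaired letters `i` of `w`, `n` are closed by earlier letters `i+1`. The paired letters
`i` stay, and among the remaining unpaired letters of both kinds the first `s` become `i`. -/
lemma count_sigmaAux_low (i : ℕ) (w : Word) : ∀ n s : ℕ, n ≤ unpairedLow i w →
    (sigmaAux i n s w).count i + unpairedLow i w = w.count i + n +
      min s (unpairedLow i w - n + (w.count (i + 1) + unpairedLow i w - w.count i)) := by
  induction w with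
  | nil => intro n s h; simp_all [unpairedLow, sigmaAux]
  | cons x w ih =>
    intro n s h
    rw [sigmaAux]
    rw [unpairedLow_cons] at h ⊢
    have hb := unpairedLow_bounds i w
    by_cases hx : x = i
    · simp only [hx, if_true, List.count_cons, beq_iff_eq] at h ⊢
      rw [if_neg (show ¬ i = i + 1 by omega)]
      by_cases hn : 0 < n
      · have a0 := ih (n - 1) s (by omega)
        simp only [hn, if_true, List.count_cons_self]
        omega
      · have a1 := ih n (s - 1) (by omega)
        simp only [hn, if_false, List.count_cons, beq_iff_eq]
        split_ifs <;> omega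
    · by_cases hx' : x = i + 1
      · simp only [hx', if_true, List.count_cons, beq_iff_eq, show ¬ i + 1 = i by omega, if_false]
          at h ⊢
        by_cases hn : 0 < unpairedLow i w
        · have a0 := ih (n + 1) s (by omega)
          simp only [hn, if_true, List.count_cons, beq_iff_eq, show ¬ i + 1 = i by omega, if_false]
          omega
        · have a1 := ih n (s - 1) (by omega)
          simp only [hn, if_false, List.count_cons, beq_iff_eq]
          split_ifs <;> omega
      · have a2 := ih n s (by simpa [hx, hx'] using h)
        simpa [hx, hx', List.count_cons] using a2

lemma count_sigma (i j : ℕ) (w : Word) :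
    (sigma i w).count j = w.count (Equiv.swap i (i + 1) j) := by
  have h0 := unpairedHigh_aux i w 0
  have h1 := count_sigmaAux_low i w 0 (unpairedHigh i w) (Nat.zero_le _)
  have h2 := count_sigmaAux_add i w 0 (unpairedHigh i w)
  have h3 := unpairedLow_bounds i w
  change unpairedHigh i w + _ = _ at h0
  rw [sigma]
  rcases eq_or_ne j i with rfl | hi
  · rw [Equiv.swap_apply_left]; omega
  · rcases eq_or_ne j (i + 1) with rfl | hj
    · rw [Equiv.swap_apply_right]; omega
    · rw [Equiv.swap_apply_of_ne_of_ne hi hj, count_sigmaAux_of_ne i j hi hj]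

/-! ### The action of `σ_i` on a row -/

lemma sigmaAux_append_of_ne (i : ℕ) (A : List ℕ) (hA : ∀ x ∈ A, x ≠ i ∧ x ≠ i + 1) (n s : ℕ)
    (w : Word) : sigmaAux i n s (A ++ w) = A ++ sigmaAux i n s w := by
  induction A with
  | nil => rfl
  | cons x A ih =>
    have hx := hA x (by simp)
    rw [List.cons_append, sigmaAux, if_neg hx.1, if_neg hx.2,
      ih fun y hy => hA y (by simp [hy]), List.cons_append]

lemma unpairedLow_append_of_ne (i : ℕ) (A : List ℕ) (hA : ∀ x ∈ A, x ≠ i ∧ x ≠ i + 1)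
    (w : Word) : unpairedLow i (A ++ w) = unpairedLow i w := by
  induction A with
  | nil => rfl
  | cons x A ih =>
    have hx := hA x (by simp)
    rw [List.cons_append, unpairedLow_cons, if_neg hx.1, if_neg hx.2,
      ih fun y hy => hA y (by simp [hy])]

lemma unpairedLow_replicate_low (i a : ℕ) (w : Word) :
    unpairedLow i (List.replicate a i ++ w) = a + unpairedLow i w := by
  induction a with
  | zero => simp
  | succ a ih => rw [List.replicate_succ, List.cons_append, unpairedLow_cons, if_pos rfl, ih]; omega

lemma unpairedLow_replicate_high (i b : ℕ) (w : Word) :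
    unpairedLow i (List.replicate b (i + 1) ++ w) = unpairedLow i w - b := by
  induction b with
  | zero => simp
  | succ b ih =>
    rw [List.replicate_succ, List.cons_append, unpairedLow_cons, if_neg (by omega), if_pos rfl, ih]
    omega

/-- In a block of letters `i`, the first `n` close open pairs, the next `s` use up the quota, and
the rest are raised. -/
lemma sigmaAux_replicate_low (i a : ℕ) (w : Word) : ∀ n s,
    sigmaAux i n s (List.replicate a i ++ w) =
      List.replicate (min a (n + s)) i ++ (List.replicate (a - (n + s)) (i + 1) ++
        sigmaAux i (n - a) (s - (a - n)) w) := by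
  induction a with
  | zero => simp
  | succ a ih =>
    intro n s
    rw [List.replicate_succ, List.cons_append, sigmaAux, if_pos rfl, ih, ih]
    by_cases hn : 0 < n
    · rw [if_pos hn, show min (a + 1) (n + s) = min a (n - 1 + s) + 1 by omega,
        List.replicate_succ, List.cons_append, show a + 1 - (n + s) = a - (n - 1 + s) by omega,
        show n - (a + 1) = n - 1 - a by omega, show a + 1 - n = a - (n - 1) by omega]
    · obtain rfl : n = 0 := by omega
      rw [if_neg hn]
      by_cases hs : 0 < s
      · rw [if_pos hs, show min (a + 1) (0 + s) = min a (0 + (s - 1)) + 1 by omega,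
          List.replicate_succ, List.cons_append, show a + 1 - (0 + s) = a - (0 + (s - 1)) by omega,
          show 0 - (a + 1) = 0 - a by omega, show s - (a + 1 - 0) = s - 1 - (a - 0) by omega]
      · obtain rfl : s = 0 := by omega
        simp [List.replicate_succ]

/-- In a block of letters `i+1`, the last ones pair with the unpaired letters `i` of `w`; those
before them are unpaired and are lowered while the quota `s` lasts. -/
lemma sigmaAux_replicate_high (i b : ℕ) (w : Word) : ∀ n s,
    sigmaAux i n s (List.replicate b (i + 1) ++ w) =
      List.replicate (min (b - unpairedLow i w) s) i ++
        (List.replicate (b - min (b - unpairedLow i w) s) (i + 1) ++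
        sigmaAux i (n + min b (unpairedLow i w)) (s - (b - unpairedLow i w)) w) := by
  induction b with
  | zero => simp
  | succ b ih =>
    intro n s
    rw [List.replicate_succ, List.cons_append, sigmaAux, if_neg (by omega), if_pos rfl, ih, ih,
      unpairedLow_replicate_high]
    set L := unpairedLow i w
    by_cases hL : 0 < L - b
    · rw [if_pos hL, show min (b - L) s = 0 by omega, show min (b + 1 - L) s = 0 by omega,
        show n + 1 + min b L = n + min (b + 1) L by omega, show b - L = b + 1 - L by omega]
      simp [List.replicate_succ]
    · rw [if_neg hL]
      by_cases hs : 0 < s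
      · rw [if_pos hs, show min (b + 1 - L) s = min (b - L) (s - 1) + 1 by omega,
          List.replicate_succ, List.cons_append,
          show b + 1 - (min (b - L) (s - 1) + 1) = b - min (b - L) (s - 1) by omega,
          show min (b + 1) L = min b L by omega, show s - 1 - (b - L) = s - (b + 1 - L) by omega]
      · obtain rfl : s = 0 := by omega
        simp only [lt_irrefl, if_false, Nat.min_zero, Nat.zero_sub, Nat.sub_zero,
          List.replicate_zero, List.nil_append, List.replicate_succ, List.cons_append,
          show min (b + 1) L = min b L by omega]

lemma exists_split_of_sorted (x : ℕ) {r : List ℕ} (hr : r.Pairwise (· ≤ ·)) :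
    ∃ A B, r = A ++ B ∧ (∀ y ∈ A, y ≤ x) ∧ ∀ y ∈ B, x < y := by
  induction r with
  | nil => exact ⟨[], [], by simp⟩
  | cons y r ih =>
    rw [List.pairwise_cons] at hr
    by_cases hy : y ≤ x
    · obtain ⟨A, B, rfl, hA, hB⟩ := ih hr.2
      exact ⟨y :: A, B, rfl, by simpa [hy] using hA, hB⟩
    · refine ⟨[], y :: r, rfl, by simp, ?_⟩
      intro z hz
      rcases List.mem_cons.1 hz with rfl | hz
      · omega
      · have := hr.1 z hz; omega

lemma exists_blocks_of_sorted {i : ℕ} (hi : 0 < i) {r : List ℕ} (hr : r.Pairwise (· ≤ ·)) :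
    ∃ A a b B, r = A ++ (List.replicate a i ++ (List.replicate b (i + 1) ++ B)) ∧
      (∀ y ∈ A, y < i) ∧ ∀ y ∈ B, i + 1 < y := by
  obtain ⟨A, B, rfl, hA, hB⟩ := exists_split_of_sorted (i - 1) hr
  rw [List.pairwise_append] at hr
  obtain ⟨C, B, rfl, hC, hB'⟩ := exists_split_of_sorted i hr.2.1
  rw [List.pairwise_append] at hr
  obtain ⟨D, B, rfl, hD, hB''⟩ := exists_split_of_sorted (i + 1) hr.2.1.2.1
  refine ⟨A, C.length, D.length, B, ?_, fun y hy => ?_, hB''⟩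
  · have h1 : C = List.replicate C.length i := List.eq_replicate_iff.2 ⟨rfl, fun y hy => by
      have := hC y hy; have := hB y (by simp [hy]); omega⟩
    have h2 : D = List.replicate D.length (i + 1) := List.eq_replicate_iff.2 ⟨rfl, fun y hy => by
      have := hD y hy; have := hB' y (by simp [hy]); omega⟩
    rw [← h1, ← h2]
  · have := hA y hy; omega

/-- `σ_i` changes one value of the counting function of each row; the bounds on the new value are
those which the neighbouring rows need. -/
lemma exists_sigmaAux_row {i : ℕ} (hi : 0 < i) {r : List ℕ} (hr : r.Pairwise (· ≤ ·)) (n s : ℕ)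
    (w : Word) : ∃ r' s', sigmaAux i n s (r ++ w) = r' ++ sigmaAux i
        (n - (cntLE i r - cntLE (i - 1) r) + min (cntLE (i + 1) r - cntLE i r) (unpairedLow i w))
        s' w ∧
      r'.length = r.length ∧ r'.Pairwise (· ≤ ·) ∧ (∀ x ≠ i, cntLE x r' = cntLE x r) ∧
      min (cntLE i r) (cntLE (i - 1) r + n) ≤ cntLE i r' ∧
      cntLE i r' ≤ cntLE i r + (cntLE (i + 1) r - cntLE i r - unpairedLow i w) ∧
      unpairedLow i (r ++ w) = cntLE i r - cntLE (i - 1) r +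
        (unpairedLow i w - (cntLE (i + 1) r - cntLE i r)) := by
  obtain ⟨A, a, b, B, rfl, hA, hB⟩ := exists_blocks_of_sorted hi hr
  have hA' : ∀ x ∈ A, x ≠ i ∧ x ≠ i + 1 := fun x hx => by have := hA x hx; omega
  have hB' : ∀ x ∈ B, x ≠ i ∧ x ≠ i + 1 := fun x hx => by have := hB x hx; omega
  have cA : ∀ x, i - 1 ≤ x → cntLE x A = A.length := fun x hx =>
    cntLE_eq_length.2 fun y hy => by have := hA y hy; omega
  have cB : ∀ x, x ≤ i + 1 → cntLE x B = 0 := fun x hx =>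
    cntLE_eq_zero.2 fun y hy => by have := hB y hy; omega
  have key : ∀ a b x, cntLE x (A ++ (List.replicate a i ++ (List.replicate b (i + 1) ++ B))) =
      cntLE x A + ((if i ≤ x then a else 0) + ((if i + 1 ≤ x then b else 0) + cntLE x B)) := by
    intro a b x; simp only [cntLE_append, cntLE_replicate]
  have c0 : ∀ a b, cntLE (i - 1) (A ++ (List.replicate a i ++ (List.replicate b (i + 1) ++ B))) =
      A.length := by
    intro a b
    rw [key, cA _ le_rfl, cB _ (by omega), if_neg (by omega), if_neg (by omega)]; rfl
  have c1 : ∀ a b, cntLE i (A ++ (List.replicate a i ++ (List.replicate b (i + 1) ++ B))) =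
      A.length + a := by
    intro a b
    rw [key, cA _ (by omega), cB _ (by omega), if_pos le_rfl, if_neg (by omega)]; omega
  have c2 : ∀ a b, cntLE (i + 1) (A ++ (List.replicate a i ++ (List.replicate b (i + 1) ++ B))) =
      A.length + a + b := by
    intro a b
    rw [key, cA _ (by omega), cB _ (by omega), if_pos (by omega), if_pos le_rfl]; omega
  set L := unpairedLow i w with hL
  rw [c0, c1, c2]
  -- Number of letters `i` in the new row: those kept from the old `i`-block plus those lowered from
  -- the `(i+1)`-block.
  set a' := min a (n + s) + min (b - L) (s - (a - n)) with ha'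
  refine ⟨A ++ (List.replicate a' i ++ (List.replicate (a + b - a') (i + 1) ++ B)),
    s - (a - n) - (b - L), ?_, ?_, ?_, ?_, ?_, ?_, ?_⟩
  · simp only [List.append_assoc]
    rw [sigmaAux_append_of_ne i A hA', sigmaAux_replicate_low, sigmaAux_replicate_high,
      unpairedLow_append_of_ne i B hB', sigmaAux_append_of_ne i B hB', ← hL,
      show n - (A.length + a - A.length) + min (A.length + a + b - (A.length + a)) L =
        n - a + min b L by omega, ha']
    congr 1
    -- The row stays sorted because either no letter of the `i`-block is raised, or the quota is
    -- exhausted there and nothing in the `(i+1)`-block is lowered.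
    by_cases h : a ≤ n + s
    · rw [show a - (n + s) = 0 by omega, List.replicate_add,
        show a + b - (min a (n + s) + min (b - L) (s - (a - n))) = b - min (b - L) (s - (a - n)) by
          omega]
      simp only [List.replicate_zero, List.nil_append, List.append_assoc]
    · rw [show min (b - L) (s - (a - n)) = 0 by omega,
        show a + b - (min a (n + s) + 0) = (a - (n + s)) + b by omega,
        ← List.replicate_append_replicate (m := b)]
      simp only [List.replicate_zero, List.nil_append, List.append_assoc, Nat.add_zero,
        Nat.sub_zero]
  · simp only [List.length_append, List.length_replicate]; omega
  · simp only [List.pairwise_append, List.pairwise_replicate, List.mem_append,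
      List.mem_replicate] at hr ⊢
    refine ⟨hr.1, ⟨by simp, ⟨by simp, hr.2.1.2.1.2.1, ?_⟩, ?_⟩, ?_⟩
    · rintro x ⟨-, rfl⟩ y hy; have := hB y hy; omega
    · rintro x ⟨-, rfl⟩ y (⟨-, rfl⟩ | hy)
      · omega
      · have := hB y hy; omega
    · rintro x hx y (⟨-, rfl⟩ | ⟨-, rfl⟩ | hy)
      · have := hA x hx; omega
      · have := hA x hx; omega
      · have := hA x hx; have := hB y hy; omega
  · intro x hx
    rw [key, key]
    split_ifs <;> omega
  · rw [c1]; omega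
  · rw [c1]; omega
  · simp only [List.append_assoc]
    rw [unpairedLow_append_of_ne i A hA', unpairedLow_replicate_low, unpairedLow_replicate_high,
      unpairedLow_append_of_ne i B hB', ← hL]
    omega

/-! ### The action of `σ_i` on tableaux -/

/-- Rows come in reading order, so `u` is the old row lying above `R` and `u'` its image. The last
two hypotheses carry the pairing information downwards: only letters `i+1` of `u` without a partner
below may have been lowered, and at least the partnered ones are still open when `R` is read. -/
lemma exists_sigmaAux_rows {i : ℕ} (hi : 0 < i) (R : List (List ℕ)) :
    ∀ (u u' : List ℕ) (n s : ℕ), (∀ r ∈ R, IsRow r) →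
      (u :: R).IsChain (fun s r => Fits r s) →
      (∀ x ≠ i, cntLE x u' = cntLE x u) →
      cntLE i u' ≤ cntLE i u + (cntLE (i + 1) u - cntLE i u - unpairedLow i R.flatten) →
      min (cntLE (i + 1) u - cntLE i u) (unpairedLow i R.flatten) ≤ n →
      ∃ R' : List (List ℕ), sigmaAux i n s R.flatten = R'.flatten ∧
        R'.map List.length = R.map List.length ∧ (∀ r ∈ R', IsRow r) ∧
        (u' :: R').IsChain (fun s r => Fits r s) := by
  induction R with
  | nil => exact fun u u' n s _ _ _ _ _ => ⟨[], by simp [sigmaAux]⟩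
  | cons r R ih =>
    intro u u' n s hR hc hu' hi' hn
    rw [List.forall_mem_cons] at hR
    rw [List.isChain_cons_cons] at hc
    obtain ⟨r', s', hr', hlen, hsort, hcnt, hlow, hup, hL⟩ :=
      exists_sigmaAux_row hi hR.1.2.1 n s R.flatten
    rw [List.flatten_cons] at hn hi' ⊢
    have m1 := cntLE_mono (show i - 1 ≤ i by omega) r
    have m2 := cntLE_mono (show i ≤ i + 1 by omega) r
    have m3 := cntLE_mono (show i ≤ i + 1 by omega) u
    have f1 := hc.1 i
    have f2 := hc.1 (i - 1)
    rw [show i - 1 + 1 = i by omega] at f2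
    obtain ⟨R', h1, h2, h3, h4⟩ := ih r r' _ s' hR.2 hc.2 hcnt hup (Nat.le_add_left _ _)
    refine ⟨r' :: R', ?_, ?_, ?_, ?_⟩
    · rw [hr', h1, List.flatten_cons]
    · simp [hlen, h2]
    · rw [List.forall_mem_cons]
      refine ⟨⟨?_, hsort, ?_⟩, h3⟩
      · rw [← List.length_pos_iff, hlen, List.length_pos_iff]; exact hR.1.1
      · rw [hcnt 0 (by omega)]; exact hR.1.2.2
    · rw [List.isChain_cons_cons]
      refine ⟨fun x => ?_, h4⟩
      -- Only the count at `i` changes, so two inequalities are at stake. For `x = i` the lower row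
      -- must keep enough letters `i`, by the lower bound `hlow` and `hn`; for `x + 1 = i` the upper
      -- row must not gain too many, by `hi'`.
      rcases eq_or_ne x i with rfl | hx
      · rw [hu' _ (by omega)]; omega
      · rw [hcnt x hx]
        rcases eq_or_ne (x + 1) i with rfl | hx'
        · simp only [Nat.add_sub_cancel] at *; omega
        · rw [hu' _ hx']; exact hc.1 x

lemma splitLengths_flatten_of_map_length (R : List (List ℕ)) (sz : List ℕ)
    (h : R.map List.length = sz) : sz.splitLengths R.flatten = R := by
  subst h
  induction R with
  | nil => rfl
  | cons r R ih => simp [ih]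

lemma onWord_eq {f : Word → Word} {T U : Filling} (hs : shape U = shape T)
    (hw : word U = f (word T)) : onWord f T = U := by
  rw [onWord, ← hw, word, splitLengths_flatten_of_map_length, List.reverse_reverse]
  rw [List.map_reverse, List.map_reverse]
  exact congrArg List.reverse hs

lemma exists_word_eq_sigma {i : ℕ} (hi : 0 < i) {T : Filling} (hT : IsTableau T) :
    ∃ U, IsTableau U ∧ shape U = shape T ∧ word U = sigma i (word T) := by
  rw [isTableau_iff] at hT
  obtain ⟨R, h1, h2, h3, h4⟩ := exists_sigmaAux_rows hi T.reverse [] [] 0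
    (unpairedHigh i (word T)) (by simpa using hT.1)
    (List.isChain_cons.2 ⟨fun r _ x => by simp [cntLE_nil], List.isChain_reverse.2 hT.2⟩)
    (fun _ _ => rfl) (by simp [cntLE_nil]) (by simp [cntLE_nil])
  refine ⟨R.reverse, ?_, ?_, ?_⟩
  · rw [isTableau_iff]
    exact ⟨by simpa using h3, List.isChain_reverse.2 (List.isChain_cons.1 h4).2⟩
  · rw [shape, List.map_reverse, h2, List.map_reverse, List.reverse_reverse, shape]
  · rw [word, List.reverse_reverse, ← h1, sigma, word]

lemma exists_word_eq_foldr_sigma (l : List ℕ) (hl : ∀ i ∈ l, 0 < i) {T : Filling}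
    (hT : IsTableau T) :
    ∃ U, IsTableau U ∧ shape U = shape T ∧ word U = l.foldr sigma (word T) := by
  induction l with
  | nil => exact ⟨T, hT, rfl, rfl⟩
  | cons i l ih =>
    rw [List.forall_mem_cons] at hl
    obtain ⟨U, h1, h2, h3⟩ := ih hl.2
    obtain ⟨V, h4, h5, h6⟩ := exists_word_eq_sigma hl.1 h1
    exact ⟨V, h4, h5.trans h2, by rw [h6, h3]; rfl⟩

/-- The product `σ_1 ⋯ σ_m` moves the multiplicity of `m+1` to the letter 1 and shifts the others up
by one. This is how promotion prepends the new part to the content. -/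
lemma count_foldr_sigma (m : ℕ) : ∀ (w : Word) (j : ℕ), 0 < j →
    ((List.range' 1 m).foldr sigma w).count j =
      w.count (if j = 1 then m + 1 else if j ≤ m + 1 then j - 1 else j) := by
  induction m with
  | zero =>
    intro w j hj
    simp only [List.range'_zero, List.foldr_nil]
    congr 1
    split_ifs <;> omega
  | succ m ih =>
    intro w j hj
    rw [List.range'_concat, List.foldr_append, ih _ _ hj, List.foldr_cons, List.foldr_nil,
      count_sigma]
    congr 1
    rw [Equiv.swap_apply_def]
    split_ifs <;> omega

/-! ### Contents of tableaux -/

/-- The `i`-th entry of `mu` is the number of letters `i` of `T`, and there are no others. -/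
def HasContent (T : Filling) (mu : List ℕ) : Prop := ∀ i, (word T).count (i + 1) = mu.getD i 0

lemma word_perm (T : Filling) : (word T).Perm T.flatten := (List.reverse_perm T).flatten

lemma cntLE_perm {r s : List ℕ} (h : r.Perm s) (x : ℕ) : cntLE x r = cntLE x s := h.countP_eq _

lemma cntLE_zero_word {T : Filling} (hT : IsTableau T) : cntLE 0 (word T) = 0 := by
  rw [cntLE_eq_zero]
  intro y hy
  obtain ⟨r, hr, hy⟩ := List.mem_flatten.1 ((word_perm T).mem_iff.1 hy)
  exact (hT.1 r hr).2.2 y hy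

lemma length_word (T : Filling) : (word T).length = (shape T).sum := by
  rw [(word_perm T).length_eq, List.length_flatten, shape]

lemma word_cons (r : List ℕ) (T : Filling) : word (r :: T) = word T ++ r := by
  simp [word]

lemma sum_take_succ_getD (l : List ℕ) (j : ℕ) :
    (l.take (j + 1)).sum = (l.take j).sum + l.getD j 0 := by
  induction l generalizing j with
  | nil => simp
  | cons a l ih =>
    cases j with
    | zero => simp
    | succ j => simp [ih, Nat.add_assoc]

lemma HasContent.cntLE_eq {T : Filling} {mu : List ℕ} (hT : IsTableau T) (h : HasContent T mu)
    (j : ℕ) : cntLE j (word T) = (mu.take j).sum := by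
  induction j with
  | zero => simpa using cntLE_zero_word hT
  | succ j ih => rw [cntLE_succ, ih, h j, sum_take_succ_getD]

lemma HasContent.sum_eq {T : Filling} {mu : List ℕ} (hT : IsTableau T) (h : HasContent T mu) :
    mu.sum = (shape T).sum := by
  have h1 := h.cntLE_eq hT (mu.length + (word T).sum)
  rw [List.take_of_length_le (by omega)] at h1
  rw [← h1, ← length_word, cntLE_eq_length.2]
  intro y hy
  have := List.single_le_sum (fun _ _ => Nat.zero_le _) y hy
  omega

/-- By column strictness the entries of row `j`, counted from 0, exceed `b + j`, so letters at most
`b + j` lie in the first `j` rows. The offset `b` lets the induction pass to the upper rows. -/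
lemma cntLE_flatten_le {T : Filling} : ∀ {b : ℕ}, IsTableau T → (∀ r ∈ T.head?, cntLE b r = 0) →
    ∀ j, cntLE (b + j) T.flatten ≤ ((shape T).take j).sum := by
  induction T with
  | nil => simp [cntLE_nil]
  | cons r T ih =>
    intro b hT hb j
    rw [isTableau_cons] at hT
    have hr : cntLE b r = 0 := hb r (by simp)
    have ih' := ih (b := b + 1) hT.2.2 fun s hs => by have := hT.2.1 s hs b; omega
    rw [List.flatten_cons, cntLE_append]
    cases j with
    | zero =>
      have h1 := ih' 0
      have h2 := cntLE_mono (show b + 0 ≤ b + 1 + 0 by omega) T.flatten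
      simp only [List.take_zero, List.sum_nil, Nat.add_zero] at *
      omega
    | succ j =>
      have h1 := ih' j
      rw [show b + 1 + j = b + (j + 1) by omega] at h1
      have h2 := cntLE_le_length (b + (j + 1)) r
      simp only [shape, List.map_cons, List.take_succ_cons, List.sum_cons] at *
      omega

/-- The tableau whose rows are constant, with consecutive entries from `b + 1` on. -/
def superstandard : ℕ → List ℕ → Filling
  | _, [] => []
  | b, a :: l => List.replicate a (b + 1) :: superstandard (b + 1) l

/-- Equality for `j = 1` forces the bottom row to be constant; removing it leaves the same
equalities with `b + 1`. -/
lemma eq_superstandard {T : Filling} : ∀ {b : ℕ}, IsTableau T → (∀ r ∈ T.head?, cntLE b r = 0) →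
    (∀ j, cntLE (b + j) T.flatten = ((shape T).take j).sum) → T = superstandard b (shape T) := by
  induction T with
  | nil => intros; rfl
  | cons r T ih =>
    intro b hT hb hj
    rw [isTableau_cons] at hT
    have hr : cntLE b r = 0 := hb r (by simp)
    have hb' : ∀ s ∈ T.head?, cntLE (b + 1) s = 0 := fun s hs => by have := hT.2.1 s hs b; omega
    have h1 := cntLE_flatten_le hT.2.2 hb' 0
    have h2 := hj 1
    simp only [List.flatten_cons, cntLE_append, shape, List.map_cons, List.take_succ_cons,
      List.sum_cons, List.take_zero, List.sum_nil, Nat.add_zero, Nat.le_zero] at h1 h2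
    rw [h1, Nat.add_zero] at h2
    have h3 : r = List.replicate r.length (b + 1) := List.eq_replicate_iff.2 ⟨rfl, fun y hy => by
      have := cntLE_eq_length.1 h2 y hy
      have := cntLE_eq_zero.1 hr y hy
      omega⟩
    have h4 := ih hT.2.2 hb' fun j => by
      have h5 := hj (j + 1)
      simp only [List.flatten_cons, cntLE_append, shape, List.map_cons, List.take_succ_cons,
        List.sum_cons] at h5
      have h6 := cntLE_mono (show b + 1 ≤ b + (j + 1) by omega) r
      have h7 := cntLE_le_length (b + (j + 1)) r
      rw [show b + 1 + j = b + (j + 1) by omega, shape]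
      omega
    change r :: T = List.replicate r.length (b + 1) :: superstandard (b + 1) (shape T)
    rw [← h3, ← h4]

lemma HasContent.dominance {T : Filling} {mu : List ℕ} (hT : IsTableau T) (h : HasContent T mu)
    (i : ℕ) : (mu.take i).sum ≤ ((shape T).take i).sum := by
  rw [← h.cntLE_eq hT i, cntLE_perm (word_perm T)]
  have := cntLE_flatten_le (b := 0) hT
    (fun r hr => ((isTableau_iff T).1 hT).1 r (List.mem_of_mem_head? hr) |>.2.2) i
  rwa [Nat.zero_add] at this

lemma HasContent.eq_superstandard {T : Filling} (hT : IsTableau T) (h : HasContent T (shape T)) :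
    T = superstandard 0 (shape T) := by
  apply TableauAtoms.eq_superstandard hT
    (fun r hr => ((isTableau_iff T).1 hT).1 r (List.mem_of_mem_head? hr) |>.2.2)
  intro j
  rw [Nat.zero_add, ← h.cntLE_eq hT j, cntLE_perm (word_perm T)]

lemma shape_superstandard (b : ℕ) (l : List ℕ) : shape (superstandard b l) = l := by
  induction l generalizing b with
  | nil => rfl
  | cons a l ih =>
    have := ih (b + 1)
    rw [shape] at this
    simp [superstandard, shape, this]

lemma isPartition_cons {a : ℕ} {l : List ℕ} :
    IsPartition (a :: l) ↔ (∀ c ∈ l, c ≤ a) ∧ 0 < a ∧ IsPartition l := by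
  simp only [IsPartition, List.pairwise_cons, List.forall_mem_cons]
  tauto

lemma isTableau_superstandard (b : ℕ) {l : List ℕ} (hl : IsPartition l) :
    IsTableau (superstandard b l) := by
  induction l generalizing b with
  | nil => exact isTableau_nil
  | cons a l ih =>
    rw [isPartition_cons] at hl
    rw [superstandard, isTableau_cons]
    refine ⟨⟨by simp; omega, by simp, by simp [cntLE_replicate]⟩, ?_, ih _ hl.2.2⟩
    cases l with
    | nil => simp [superstandard]
    | cons c l =>
      simp only [superstandard, List.head?_cons, Option.mem_def, Option.some.injEq,
        forall_eq']
      intro x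
      have := hl.1 c (by simp)
      rw [cntLE_replicate, cntLE_replicate]
      split_ifs <;> omega

lemma mem_word_superstandard (b : ℕ) {l : List ℕ} (hl : IsPartition l) (x : ℕ) :
    x ∈ word (superstandard b l) ↔ b < x ∧ x ≤ b + l.length := by
  induction l generalizing b with
  | nil => simp [superstandard, word]
  | cons a l ih =>
    rw [isPartition_cons] at hl
    rw [superstandard, word_cons, List.mem_append, ih _ hl.2.2, List.mem_replicate,
      List.length_cons]
    omega

lemma count_word_superstandard (b : ℕ) (l : List ℕ) (i : ℕ) :
    (word (superstandard b l)).count (b + i + 1) = l.getD i 0 := by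
  induction l generalizing b i with
  | nil => simp [superstandard, word]
  | cons a l ih =>
    rw [superstandard, word_cons, List.count_append, List.count_replicate]
    cases i with
    | zero =>
      have : (word (superstandard (b + 1) l)).count (b + 0 + 1) = 0 := by
        have h : cntLE (b + 1) (word (superstandard (b + 1) l)) = 0 := by
          clear ih
          rw [cntLE_eq_zero]
          induction l generalizing b with
          | nil => simp [superstandard, word]
          | cons c l ih =>
            intro y hy
            rw [superstandard, word_cons, List.mem_append, List.mem_replicate] at hy
            rcases hy with hy | hy
            · have := ih (b + 1) y hy; omega
            · omega
        have := cntLE_succ b (word (superstandard (b + 1) l))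
        rw [Nat.add_zero]; omega
      simp [this]
    | succ i =>
      have h := ih (b + 1) i
      rw [show b + 1 + i + 1 = b + (i + 1) + 1 by omega] at h
      simp [h]

lemma hasContent_superstandard (l : List ℕ) : HasContent (superstandard 0 l) l := fun i => by
  have := count_word_superstandard 0 l i
  rwa [Nat.zero_add] at this

lemma maxLetter_le {w : Word} {m : ℕ} (h : ∀ x ∈ w, x ≤ m) : maxLetter w ≤ m := by
  induction w with
  | nil => simp [maxLetter]
  | cons x w ih =>
    rw [List.forall_mem_cons] at h
    exact max_le h.1 (ih h.2)

lemma le_maxLetter {w : Word} {x : ℕ} (h : x ∈ w) : x ≤ maxLetter w := by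
  induction w with
  | nil => simp at h
  | cons y w ih =>
    change x ≤ max y (maxLetter w)
    rcases List.mem_cons.1 h with rfl | h
    · exact le_max_left _ _
    · exact le_max_of_le_right (ih h)

lemma maxLetter_word {T : Filling} {mu : List ℕ} (h : HasContent T mu) (hmu : IsPartition mu) :
    maxLetter (word T) = mu.length := by
  apply le_antisymm
  · refine maxLetter_le fun x hx => ?_
    by_contra! hc
    have h1 := h (x - 1)
    rw [show x - 1 + 1 = x by omega, List.getD_eq_default _ _ (by omega), List.count_eq_zero] at h1
    exact h1 hx
  · rcases Nat.eq_zero_or_pos mu.length with h0 | h0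
    · omega
    · have h1 := h (mu.length - 1)
      rw [List.getD_eq_getElem _ _ (by omega), show mu.length - 1 + 1 = mu.length by omega] at h1
      exact le_maxLetter (List.count_pos_iff.1 (h1 ▸ hmu.2 _ (List.getElem_mem _)))

/-! ### Adding horizontal strips -/

/-- The clause about the bottom row of `U` is what the row beneath needs in the induction: `cap` is
that row's old length, so every new `x` sits above an old, smaller letter. -/
lemma addStrip_spec {x : ℕ} (hx : 0 < x) {rows : Filling} : ∀ {cap r : ℕ} {U : Filling},
    IsTableau rows → (∀ y ∈ rows.flatten, y < x) → U ∈ addStrip x cap rows r →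
    IsTableau U ∧ (∀ y, U.flatten.count y = rows.flatten.count y + if y = x then r else 0) ∧
    ∀ s ∈ U.head?, s.length ≤ cap ∧ ∀ y < x, cntLE y s = cntLE y (rows.headD []) := by
  induction rows with
  | nil =>
    intro cap r U _ _ hU
    rw [addStrip] at hU
    split_ifs at hU with h1 h2
    · obtain rfl := Finset.mem_singleton.1 hU
      simp [isTableau_nil, h1]
    · obtain rfl := Finset.mem_singleton.1 hU
      refine ⟨?_, ?_, ?_⟩
      · rw [isTableau_cons]
        refine ⟨⟨by simp; omega, by simp, by rw [cntLE_replicate, if_neg (by omega)]⟩, by simp,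
          isTableau_nil⟩
      · intro y
        rw [List.flatten_singleton, List.count_replicate]
        rcases eq_or_ne y x with rfl | h
        · simp
        · simp [h, h.symm]
      · simp only [List.head?_cons, Option.mem_def, Option.some.injEq, forall_eq',
          List.length_replicate]
        exact ⟨h2, fun y hy => by rw [cntLE_replicate, if_neg (by omega)]; rfl⟩
    · simp at hU
  | cons row rows ih =>
    intro cap r U hT hlt hU
    rw [addStrip, Finset.mem_biUnion] at hU
    obtain ⟨c, hc, hU⟩ := hU
    rw [Finset.mem_filter, Finset.mem_range] at hc
    obtain ⟨V, hV, rfl⟩ := Finset.mem_image.1 hU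
    rw [isTableau_cons] at hT
    rw [List.flatten_cons] at hlt
    obtain ⟨h1, h2, h3⟩ := ih hT.2.2 (fun y hy => hlt y (List.mem_append_right _ hy)) hV
    have hrow : ∀ y ∈ row, y < x := fun y hy => hlt y (List.mem_append_left _ hy)
    have hcnt : ∀ y < x, cntLE y (row ++ List.replicate c x) = cntLE y row := fun y hy => by
      rw [cntLE_append, cntLE_replicate, if_neg (by omega), Nat.add_zero]
    refine ⟨?_, ?_, ?_⟩
    · rw [isTableau_cons]
      refine ⟨⟨by simp [hT.1.1], ?_, ?_⟩, ?_, h1⟩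
      · rw [List.pairwise_append]
        refine ⟨hT.1.2.1, by simp, fun y hy z hz => ?_⟩
        have := hrow y hy
        rw [(List.mem_replicate.1 hz).2]; omega
      · rw [hcnt 0 hx]; exact hT.1.2.2
      · intro s hs y
        obtain ⟨h4, h5⟩ := h3 s hs
        by_cases hy : y + 1 < x
        · rw [h5 _ hy, hcnt _ (by omega)]
          cases rows with
          | nil => simp [cntLE_nil]
          | cons r' rows => exact hT.2.1 r' (by simp) y
        · have h6 : cntLE y row = row.length :=
            cntLE_eq_length.2 fun z hz => by have := hrow z hz; omega
          rw [cntLE_append, h6]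
          have := cntLE_le_length (y + 1) s
          omega
    · intro y
      rw [List.flatten_cons, List.flatten_cons, List.count_append, List.count_append,
        List.count_append, h2, List.count_replicate]
      rcases eq_or_ne y x with rfl | h
      · simp only [BEq.rfl, if_true]; omega
      · simp [h, h.symm]
    · simp only [List.head?_cons, Option.mem_def, Option.some.injEq, forall_eq',
        List.headD_cons]
      exact ⟨by simpa using hc.2, hcnt⟩

/-- Each row is extended to the old length of the row beneath it, and the bottom row to `a`; the
increments telescope to `a`. -/
lemma exists_mem_addStrip (x : ℕ) {rows : Filling} : ∀ {cap a : ℕ},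
    IsPartition (a :: shape rows) → a ≤ cap →
    ∃ U ∈ addStrip x cap rows a, shape U = a :: shape rows := by
  induction rows with
  | nil =>
    intro cap a h ha
    rw [isPartition_cons] at h
    exact ⟨[List.replicate a x], by simp [addStrip, ha, h.2.1.ne'], by simp [shape]⟩
  | cons row rows ih =>
    intro cap a h ha
    rw [isPartition_cons] at h
    have h1 : row.length ≤ a := h.1 _ (by simp [shape])
    obtain ⟨U, hU, hs⟩ := ih (cap := row.length) (a := row.length) h.2.2 le_rfl
    refine ⟨(row ++ List.replicate (a - row.length) x) :: U, ?_, ?_⟩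
    · rw [addStrip, Finset.mem_biUnion]
      refine ⟨a - row.length, ?_, ?_⟩
      · rw [Finset.mem_filter, Finset.mem_range]; omega
      · rw [show a - (a - row.length) = row.length by omega]
        exact Finset.mem_image_of_mem _ hU
    · rw [shape, List.map_cons, ← shape, hs]
      simp [shape]; omega

/-! ### The tableaux of a super atom -/

lemma onWord_foldr_sigma_spec {a : ℕ} {l : List ℕ} (hl : IsPartition l) {T V : Filling}
    (hT : IsTableau T) (hTl : HasContent T l)
    (hV : V ∈ addStrip (maxLetter (word T) + 1) ((T.headD []).length + a) T a) :
    ∀ U, U = onWord (fun w => (List.range' 1 (maxLetter (word T))).foldr sigma w) V →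
      IsTableau U ∧ shape U = shape V ∧ HasContent U (a :: l) := by
  rintro U rfl
  rw [maxLetter_word hTl hl] at hV ⊢
  obtain ⟨h1, h2, -⟩ := addStrip_spec (Nat.succ_pos _) hT (fun y hy => by
    have := le_maxLetter ((word_perm T).mem_iff.2 hy)
    rw [maxLetter_word hTl hl] at this; omega) hV
  obtain ⟨W, h3, h4, h5⟩ := exists_word_eq_foldr_sigma (List.range' 1 l.length)
    (fun i hi => by rw [List.mem_range'] at hi; omega) h1
  rw [onWord_eq h4 h5]
  refine ⟨h3, h4, fun i => ?_⟩
  have h6 : ∀ y, (word V).count y = (word T).count y + if y = l.length + 1 then a else 0 :=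
    fun y => by rw [(word_perm V).count_eq, (word_perm T).count_eq, h2]
  rw [h5, count_foldr_sigma _ _ _ (Nat.succ_pos i), h6]
  cases i with
  | zero => simp [hTl l.length]
  | succ i =>
    rw [List.getD_cons_succ, ← hTl i]
    by_cases hi : i < l.length
    · rw [if_neg (by omega), if_pos (by omega), if_neg (by omega)]; rfl
    · have h7 := hTl i
      have h8 := hTl (i + 1)
      rw [List.getD_eq_default _ _ (by omega)] at h7 h8
      split_ifs
      all_goals simp_all
      omega

lemma promotion_spec {a : ℕ} {l : List ℕ} (hl : IsPartition l) {T U : Filling}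
    (hT : IsTableau T) (hTl : HasContent T l) (hU : U ∈ promotion a T) :
    IsTableau U ∧ HasContent U (a :: l) := by
  obtain ⟨V, hV, rfl⟩ := Finset.mem_image.1 hU
  obtain ⟨h1, -, h2⟩ := onWord_foldr_sigma_spec hl hT hTl hV _ rfl
  exact ⟨h1, h2⟩

lemma mem_superAtom_cons {k a : ℕ} {l : List ℕ} {T : Filling} :
    T ∈ superAtom k (a :: l) ↔
      (∃ S ∈ superAtom k l, T ∈ promotion a S) ∧ Passes (kSplit k (a :: l)) T := by
  simp only [superAtom, Finset.mem_filter, Finset.mem_biUnion]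

lemma superAtom_spec (k : ℕ) {lam : List ℕ} (hlam : IsPartition lam) :
    ∀ T ∈ superAtom k lam, IsTableau T ∧ HasContent T lam := by
  induction lam with
  | nil => simp [superAtom, isTableau_nil, HasContent, word]
  | cons a l ih =>
    intro T hT
    rw [mem_superAtom_cons] at hT
    obtain ⟨⟨S, hS, hT⟩, -⟩ := hT
    obtain ⟨h1, h2⟩ := ih (isPartition_cons.1 hlam).2.2 S hS
    exact promotion_spec (isPartition_cons.1 hlam).2.2 h1 h2 hT

/-- No `σ_i` has to be computed: some strip gives the shape `a :: l`, its image under the `σ_i` has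
that shape and that content, and only the superstandard tableau has both. -/
lemma superstandard_mem_promotion {a : ℕ} {l : List ℕ} (hl : IsPartition (a :: l)) :
    superstandard 0 (a :: l) ∈ promotion a (superstandard 0 l) := by
  have h1 := isTableau_superstandard 0 (isPartition_cons.1 hl).2.2
  have h2 := hasContent_superstandard l
  obtain ⟨V, hV, hs⟩ := exists_mem_addStrip (maxLetter (word (superstandard 0 l)) + 1)
    (rows := superstandard 0 l) (cap := ((superstandard 0 l).headD []).length + a) (a := a)
    (by rwa [shape_superstandard]) (by omega)
  rw [shape_superstandard] at hs
  refine Finset.mem_image.2 ⟨V, hV, ?_⟩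
  obtain ⟨h3, h4, h5⟩ := onWord_foldr_sigma_spec (isPartition_cons.1 hl).2.2 h1 h2 hV _ rfl
  rw [hs] at h4
  rw [← h4] at h5
  rw [h5.eq_superstandard h3, h4]

/-! ### Superstandard tableaux pass the filters -/

/-- Successive insertion of the letters of a word. -/
def insertWord (w : Word) (T : Filling) : Filling := w.foldl (fun T x => insertLetter x T) T

lemma insertWord_append (v w : Word) (T : Filling) :
    insertWord (v ++ w) T = insertWord w (insertWord v T) := List.foldl_append

lemma insertLetter_append_end {x : ℕ} {r : List ℕ} (h : ∀ y ∈ r, y ≤ x) (rs : Filling) :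
    insertLetter x (r :: rs) = (r ++ [x]) :: rs := by
  have : r.dropWhile (· ≤ x) = [] := List.dropWhile_eq_nil_iff.2 (by simpa using h)
  rw [insertLetter, this]

lemma insertLetter_bump {x y : ℕ} {r q : List ℕ} (h : ∀ y ∈ r, y ≤ x) (hy : x < y)
    (rs : Filling) :
    insertLetter x ((r ++ y :: q) :: rs) = (r ++ x :: q) :: insertLetter y rs := by
  have h1 : (r ++ y :: q).dropWhile (· ≤ x) = y :: q := by
    rw [List.dropWhile_append_of_pos (by simpa using h),
      List.dropWhile_cons_of_neg (by simpa using hy)]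
  have h2 : (r ++ y :: q).takeWhile (· ≤ x) = r := by
    rw [List.takeWhile_append_of_pos (by simpa using h),
      List.takeWhile_cons_of_neg (by simpa using hy),
      List.append_nil]
  rw [insertLetter, h1, h2]

lemma insertWord_replicate_end (x a j : ℕ) (rs : Filling) :
    insertWord (List.replicate a x) (List.replicate j x :: rs) = List.replicate (j + a) x :: rs := by
  induction a generalizing j with
  | zero => rfl
  | succ a ih =>
    rw [List.replicate_succ]
    change insertWord (List.replicate a x) (insertLetter x _) = _
    rw [insertLetter_append_end (fun y hy => (List.mem_replicate.1 hy).2.le), ← List.replicate_succ',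
      ih]
    congr 2; omega

lemma insertWord_replicate_bump {x y : ℕ} (h : x < y) (b j : ℕ) (rs : Filling) :
    insertWord (List.replicate b x) ((List.replicate j x ++ List.replicate b y) :: rs) =
      List.replicate (j + b) x :: insertWord (List.replicate b y) rs := by
  induction b generalizing j rs with
  | zero => simp [insertWord]
  | succ b ih =>
    rw [List.replicate_succ, List.replicate_succ (a := y)]
    change insertWord (List.replicate b x) (insertLetter x _) =
      _ :: insertWord (List.replicate b y) (insertLetter y rs)
    rw [insertLetter_bump (fun y hy => (List.mem_replicate.1 hy).2.le) h,
      show List.replicate j x ++ x :: List.replicate b y =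
        List.replicate (j + 1) x ++ List.replicate b y by simp [List.replicate_succ'], ih]
    congr 2; omega

/-- The first `c` inserted letters bump the `c` letters of the bottom row one by one into the rows
above, where by induction they rebuild the rest; the remaining `a - c` letters are appended. -/
lemma insertWord_superstandard (b : ℕ) {a : ℕ} {l : List ℕ} (h : IsPartition (a :: l)) :
    insertWord (List.replicate a (b + 1)) (superstandard (b + 1) l) =
      superstandard b (a :: l) := by
  induction l generalizing b a with
  | nil =>
    obtain ⟨a, rfl⟩ : ∃ c, a = c + 1 := ⟨a - 1, by have := (isPartition_cons.1 h).2.1; omega⟩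
    rw [List.replicate_succ]
    change insertWord (List.replicate a (b + 1)) [List.replicate 1 (b + 1)] = _
    rw [insertWord_replicate_end, superstandard, superstandard]
    congr 2; omega
  | cons c l ih =>
    rw [isPartition_cons] at h
    have hc : c ≤ a := h.1 c (by simp)
    obtain ⟨d, rfl⟩ := Nat.exists_eq_add_of_le hc
    rw [List.replicate_add, insertWord_append, superstandard]
    have h1 := insertWord_replicate_bump (show b + 1 < b + 1 + 1 by omega) c 0
      (superstandard (b + 1 + 1) l)
    rw [List.replicate_zero, List.nil_append] at h1
    rw [h1, insertWord_replicate_end, ih _ h.2.2, superstandard, superstandard, superstandard,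
      Nat.zero_add]

lemma rsTableau_word_superstandard (b : ℕ) {l : List ℕ} (h : IsPartition l) :
    rsTableau (word (superstandard b l)) = superstandard b l := by
  induction l generalizing b with
  | nil => rfl
  | cons a l ih =>
    have h1 := ih (b + 1) (isPartition_cons.1 h).2.2
    change insertWord _ [] = _ at h1
    change insertWord (word (_ :: _)) [] = _
    rw [word_cons, insertWord_append, h1, insertWord_superstandard b h]

lemma superstandard_append (b : ℕ) (mu nu : List ℕ) :
    superstandard b (mu ++ nu) = superstandard b mu ++ superstandard (b + mu.length) nu := by
  induction mu generalizing b with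
  | nil => rfl
  | cons a mu ih =>
    rw [List.cons_append, superstandard, ih, superstandard, List.cons_append, List.length_cons,
      show b + 1 + mu.length = b + (mu.length + 1) by omega]

lemma length_superstandard (b : ℕ) (l : List ℕ) : (superstandard b l).length = l.length := by
  rw [← List.length_map (f := List.length), ← shape, shape_superstandard]

lemma zipWith_take_superstandard (b : ℕ) (mu : List ℕ) (T : Filling) :
    List.zipWith (fun row p => row.take p) (superstandard b mu ++ T) mu = superstandard b mu := by
  induction mu generalizing b with
  | nil => simp [superstandard]
  | cons a mu ih => simp [superstandard, ih, List.take_of_length_le]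

lemma word_zipWith_drop_superstandard (b : ℕ) (mu : List ℕ) (T : Filling) :
    word (List.zipWith (fun row p => row.drop p) (superstandard b mu ++ T) mu) = [] := by
  induction mu generalizing b with
  | nil => simp [word]
  | cons a mu ih =>
    rw [superstandard, List.cons_append, List.zipWith_cons_cons, word_cons, ih]
    simp

lemma isPartition_append {mu nu : List ℕ} (h : IsPartition (mu ++ nu)) :
    IsPartition mu ∧ IsPartition nu :=
  ⟨⟨(List.pairwise_append.1 h.1).1, fun p hp => h.2 p (List.mem_append_left _ hp)⟩,
    ⟨(List.pairwise_append.1 h.1).2.1, fun p hp => h.2 p (List.mem_append_right _ hp)⟩⟩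

lemma maxLetter_superstandard (b : ℕ) {l : List ℕ} (h : IsPartition l) (hne : l ≠ []) :
    maxLetter (word (superstandard b l)) = b + l.length := by
  have hpos := List.length_pos_iff.2 hne
  apply le_antisymm
  · exact maxLetter_le fun x hx => ((mem_word_superstandard b h x).1 hx).2
  · exact le_maxLetter ((mem_word_superstandard b h _).2 (by omega))

lemma inS_superstandard (b : ℕ) {l : List ℕ} (h : IsPartition l) (hne : l ≠ []) :
    InS l (superstandard b l) := by
  refine ⟨isTableau_superstandard b h, shape_superstandard b l, b, ?_⟩
  rw [evaluation, maxLetter_superstandard b h hne]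
  apply List.ext_getElem
  · simp
  · intro i h1 h2
    simp only [List.length_map, List.length_range'] at h1
    simp only [List.getElem_map, List.getElem_range', Nat.one_mul]
    by_cases hi : i < b
    · rw [List.getElem_append_left (by simpa using hi), List.getElem_replicate,
        List.count_eq_zero, mem_word_superstandard b h]
      omega
    · rw [List.getElem_append_right (by simpa using hi)]
      have := count_word_superstandard b l (i - b)
      rw [List.getD_eq_getElem _ _ (by omega)] at this
      simp only [List.length_replicate]
      rw [← this]
      congr 1; omega

lemma restrictedKatabolism_superstandard (b : ℕ) {mu nu : List ℕ} (h : IsPartition (mu ++ nu))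
    (hne : mu ≠ []) : restrictedKatabolism mu (superstandard b (mu ++ nu)) =
      some (superstandard (b + mu.length) nu) := by
  have hc : Contained mu (superstandard b (mu ++ nu)) := fun i hi => by
    rw [shape_superstandard, List.getD_append _ _ _ _ hi]
  have hs : InS mu (subtableau mu (superstandard b (mu ++ nu))) := by
    rw [subtableau, superstandard_append, zipWith_take_superstandard]
    exact inS_superstandard b (isPartition_append h).1 hne
  rw [restrictedKatabolism, if_pos ⟨hc, hs⟩, katabolism, if_pos hc, superstandard_append,
    word_zipWith_drop_superstandard, List.nil_append, List.drop_left' (length_superstandard b mu),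
    rsTableau_word_superstandard _ (isPartition_append h).2]

/-- Each katabolism strips complete rows, leaving a superstandard tableau on larger letters; hence
the general offset `b`. -/
lemma passes_superstandard (k b : ℕ) (l : List ℕ) (h : IsPartition l) :
    Passes (kSplit k l) (superstandard b l) := by
  induction l using kSplit.induct (k := k) generalizing b with
  | case1 => rw [kSplit]; rfl
  | case2 a l ih =>
    rw [kSplit, Passes, List.foldl_cons, Option.bind_some]
    have h1 : a :: l = (a :: l.take (k - a)) ++ l.drop (k - a) := by simp
    rw [h1] at h
    rw [show superstandard b (a :: l) = superstandard b (a :: l.take (k - a) ++ l.drop (k - a)) from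
      congrArg _ h1, restrictedKatabolism_superstandard b h (by simp)]
    exact ih _ (isPartition_append h).2

lemma superstandard_mem_superAtom (k : ℕ) {lam : List ℕ} (h : IsPartition lam) :
    superstandard 0 lam ∈ superAtom k lam := by
  induction lam with
  | nil => simp [superAtom, superstandard]
  | cons a l ih =>
    rw [mem_superAtom_cons]
    exact ⟨⟨_, ih (isPartition_cons.1 h).2.2, superstandard_mem_promotion h⟩,
      passes_superstandard k 0 _ h⟩

/-! ### The charge of a superstandard tableau -/

/-- On a sorted word the letters already passed are smaller than `a`, so `a` is found, if at all,
before the separator is reached again, and the label stays 0. -/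
lemma chargeStep_sorted {s : ChargeState} {a : ℕ} (hs : (s.before ++ s.after).Pairwise (· ≤ ·))
    (hb : ∀ x ∈ s.before, x < a) (hl : s.label = 0) (ht : s.total = 0) :
    ((chargeStep s a).before ++ (chargeStep s a).after).Pairwise (· ≤ ·) ∧
    (∀ x ∈ (chargeStep s a).before, x < a + 1) ∧ (chargeStep s a).label = 0 ∧
    (chargeStep s a).total = 0 := by
  rw [chargeStep]
  split_ifs with h1 h2
  · refine ⟨?_, ?_, hl, by simp [hl, ht]⟩
    · refine hs.sublist ?_
      simp only [List.append_assoc]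
      refine List.Sublist.append_left ?_ _
      conv_rhs => rw [← List.takeWhile_append_dropWhile (p := (· ≠ a)) (l := s.after)]
      exact List.Sublist.append_left (List.tail_sublist _) _
    · intro x hx
      rcases List.mem_append.1 hx with hx | hx
      · exact (hb x hx).trans (Nat.lt_succ_self a)
      · have hs' := (List.pairwise_append.1 hs).2.1
        have hd : s.after.dropWhile (· ≠ a) ≠ [] := by
          simpa [List.dropWhile_eq_nil_iff] using h1
        have hh := List.head_dropWhile_not (fun y => decide (y ≠ a)) hd
        rw [← List.takeWhile_append_dropWhile (p := (· ≠ a)) (l := s.after),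
          List.pairwise_append] at hs'
        have h3 := hs'.2.2 x hx _ (List.head_mem hd)
        rw [show (s.after.dropWhile (· ≠ a)).head hd = a by simpa using hh] at h3
        omega
  · exact absurd (hb a h2) (lt_irrefl a)
  · exact ⟨hs, fun x hx => (hb x hx).trans (Nat.lt_succ_self a), hl, ht⟩

lemma foldl_chargeStep_sorted (n : ℕ) : ∀ (a : ℕ) (s : ChargeState),
    (s.before ++ s.after).Pairwise (· ≤ ·) → (∀ x ∈ s.before, x < a) → s.label = 0 →
    s.total = 0 →
    ((((List.range' a n).foldl chargeStep s).before ++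
      ((List.range' a n).foldl chargeStep s).after).Pairwise (· ≤ ·)) ∧
    ((List.range' a n).foldl chargeStep s).total = 0 := by
  induction n with
  | zero => exact fun a s h1 _ _ h4 => ⟨h1, h4⟩
  | succ n ih =>
    intro a s h1 h2 h3 h4
    obtain ⟨h5, h6, h7, h8⟩ := chargeStep_sorted h1 h2 h3 h4
    exact ih (a + 1) _ h5 h6 h7 h8

lemma chargeRounds_sorted (n : ℕ) : ∀ u : List ℕ, u.Pairwise (· ≤ ·) → chargeRounds n u = 0 := by
  induction n with
  | zero => exact fun _ _ => rfl
  | succ n ih =>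
    intro u hu
    obtain ⟨h1, h2⟩ := foldl_chargeStep_sorted (maxLetter u) 1 ⟨[], u, 0, 0⟩ hu (by simp) rfl rfl
    rw [chargeRounds, chargeRound, h2, ih _ h1]

lemma straighten_eq_self {w : Word} (h : ∀ i, w.count (i + 2) ≤ w.count (i + 1)) :
    straighten w = w := by
  have h1 : ∀ l : List ℕ, (∀ i ∈ l, 0 < i) →
      l.foldl (fun u i => if u.count i < u.count (i + 1) then sigma i u else u) w = w := by
    intro l
    induction l with
    | nil => exact fun _ => rfl
    | cons i l ih =>
      intro hl
      rw [List.forall_mem_cons] at hl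
      have h2 := h (i - 1)
      rw [show i - 1 + 2 = i + 1 by omega, show i - 1 + 1 = i by omega] at h2
      rw [List.foldl_cons, if_neg (by omega), ih hl.2]
  exact Function.iterate_fixed (h1 (List.range' 1 (maxLetter w - 1)) fun i hi => by
    rw [List.mem_range'] at hi; omega) _

lemma charge_superstandard {lam : List ℕ} (h : IsPartition lam) :
    charge (word (superstandard 0 lam)) = 0 := by
  rw [charge, straighten_eq_self]
  · apply chargeRounds_sorted
    rw [List.pairwise_reverse]
    generalize 0 = b
    induction lam generalizing b with
    | nil => simp [superstandard, word]
    | cons a l ih =>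
      rw [superstandard, word_cons, List.pairwise_append]
      refine ⟨ih (isPartition_cons.1 h).2.2 _, by simp, fun x hx y hy => ?_⟩
      rw [mem_word_superstandard _ (isPartition_cons.1 h).2.2] at hx
      rw [(List.mem_replicate.1 hy).2]
      omega
  · intro i
    rw [hasContent_superstandard lam (i + 1), hasContent_superstandard lam i]
    by_cases hi : i + 1 < lam.length
    · rw [List.getD_eq_getElem _ _ hi, List.getD_eq_getElem _ _ (by omega)]
      exact List.pairwise_iff_getElem.1 h.1 i (i + 1) _ _ (Nat.lt_succ_self i)
    · rw [List.getD_eq_default _ _ (by omega)]; exact Nat.zero_le _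

/-! ### Filtering hooks -/

/-- A filling with a weakly increasing bottom row and, above it, a strictly increasing column in
the first position; the bottom row and the column need not fit. -/
def IsHookFilling (T : Filling) : Prop :=
  T = [] ∨ ∃ row col : List ℕ, row ≠ [] ∧ row.Pairwise (· ≤ ·) ∧ col.Pairwise (· < ·) ∧
    T = row :: col.map (fun y => [y])

lemma insertLetter_column {x : ℕ} {col : List ℕ} (h : (x :: col).Pairwise (· < ·)) :
    insertLetter x (col.map (fun y => [y])) = (x :: col).map (fun y => [y]) := by
  induction col generalizing x with
  | nil => rfl
  | cons y col ih =>
    rw [List.pairwise_cons] at h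
    have h1 := insertLetter_bump (r := []) (q := []) (by simp) (h.1 y (by simp))
      (col.map (fun y => [y]))
    rw [List.nil_append, ih h.2] at h1
    exact h1

/-- The bumped letter is at most `z`, hence below the whole column, and enters at its foot.
Afterwards `x` plays the part of `z` for the next, smaller letter. -/
lemma insertLetter_hook {x : ℕ} {row col : List ℕ} (hrow : row.Pairwise (· ≤ ·))
    (hcol : col.Pairwise (· < ·)) {z : ℕ} (hz : z ∈ row) (hxz : x < z) (hzc : ∀ y ∈ col, z < y) :
    ∃ row' col' : List ℕ, insertLetter x (row :: col.map (fun y => [y])) =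
        row' :: col'.map (fun y => [y]) ∧ row'.Pairwise (· ≤ ·) ∧ col'.Pairwise (· < ·) ∧
        x ∈ row' ∧ ∀ y ∈ col', x < y := by
  obtain ⟨A, B, rfl, hA, hB⟩ := exists_split_of_sorted x hrow
  rw [List.pairwise_append] at hrow
  cases B with
  | nil => have := hA z (by simpa using hz); omega
  | cons e B =>
    have hxe : x < e := hB e (by simp)
    have hez : e ≤ z := by
      rcases List.mem_append.1 hz with h | h
      · have := hA z h; omega
      · rcases List.mem_cons.1 h with rfl | h
        · exact le_rfl
        · exact (List.pairwise_cons.1 hrow.2.1).1 z h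
    have hc : (e :: col).Pairwise (· < ·) :=
      List.pairwise_cons.2 ⟨fun y hy => by have := hzc y hy; omega, hcol⟩
    refine ⟨A ++ x :: B, e :: col, ?_, ?_, hc, by simp, ?_⟩
    · rw [insertLetter_bump hA hxe, insertLetter_column hc]
    · rw [List.pairwise_append, List.pairwise_cons]
      refine ⟨hrow.1, ⟨fun y hy => (hB y (by simp [hy])).le, (List.pairwise_cons.1 hrow.2.1).2⟩,
        fun y hy w hw => ?_⟩
      rcases List.mem_cons.1 hw with rfl | hw
      · exact hA y hy
      · exact hrow.2.2 y hy w (by simp [hw])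
    · intro y hy
      rcases List.mem_cons.1 hy with rfl | hy
      · exact hxe
      · have := hzc y hy; omega

lemma insertWord_hook (v : List ℕ) : ∀ {z : ℕ} {row col : List ℕ}, row.Pairwise (· ≤ ·) →
    col.Pairwise (· < ·) → z ∈ row → (∀ y ∈ col, z < y) → (z :: v).Pairwise (· > ·) →
    IsHookFilling (insertWord v (row :: col.map (fun y => [y]))) := by
  induction v with
  | nil =>
    intro z row col h1 h2 h3 _ _
    exact Or.inr ⟨row, col, List.ne_nil_of_mem h3, h1, h2, rfl⟩
  | cons x v ih =>
    intro z row col h1 h2 h3 h4 h5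
    rw [List.pairwise_cons] at h5
    obtain ⟨row', col', h, h6, h7, h8, h9⟩ := insertLetter_hook h1 h2 h3 (h5.1 x (by simp)) h4
    change IsHookFilling (insertWord v (insertLetter x _))
    rw [h]
    exact ih h6 h7 h8 h9 h5.2

lemma insertWord_sorted (u : List ℕ) : ∀ {r : List ℕ}, (r ++ u).Pairwise (· ≤ ·) →
    insertWord u [r] = [r ++ u] := by
  induction u with
  | nil => simp [insertWord]
  | cons x u ih =>
    intro r h
    change insertWord u (insertLetter x [r]) = _
    rw [insertLetter_append_end fun y hy => (List.pairwise_append.1 h).2.2 y hy x (by simp), ih]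
    · simp
    · simpa using h

/-- The increasing part builds a single row. The first letter of the decreasing part ends up in that
row, and from then on every letter bumps one entry into the column. -/
lemma rsTableau_hook {u v : List ℕ} (hu : u.Pairwise (· ≤ ·)) (hv : v.Pairwise (· > ·)) :
    IsHookFilling (rsTableau (u ++ v)) := by
  change IsHookFilling (insertWord (u ++ v) [])
  cases u with
  | nil =>
    cases v with
    | nil => exact Or.inl rfl
    | cons x v =>
      change IsHookFilling (insertWord v ([x] :: ([] : List ℕ).map (fun y => [y])))
      exact insertWord_hook v (z := x) (by simp) (by simp) (by simp) (by simp) hv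
  | cons a u =>
    rw [insertWord_append]
    have h1 : insertWord (a :: u) [] = [a :: u] := insertWord_sorted u (r := [a]) hu
    rw [h1]
    cases v with
    | nil => exact Or.inr ⟨a :: u, [], by simp, hu, by simp, rfl⟩
    | cons x v =>
      change IsHookFilling (insertWord v (insertLetter x [a :: u]))
      obtain ⟨A, B, hAB, hA, hB⟩ := exists_split_of_sorted x hu
      rw [hAB] at hu ⊢
      cases B with
      | nil =>
        rw [List.append_nil] at hu ⊢
        rw [insertLetter_append_end hA]
        refine insertWord_hook v (col := []) (z := x) ?_ (by simp) (by simp) (by simp) hv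
        rw [List.pairwise_append]
        exact ⟨hu, by simp, fun y hy w hw => by rw [List.mem_singleton.1 hw]; exact hA y hy⟩
      | cons e B =>
        obtain ⟨row', col', h, h6, h7, h8, h9⟩ := insertLetter_hook (x := x) (col := []) hu
          (by simp) (z := e) (by simp) (hB e (by simp)) (by simp)
        rw [show [A ++ e :: B] = (A ++ e :: B) :: ([] : List ℕ).map (fun y => [y]) from rfl, h]
        exact insertWord_hook v h6 h7 h8 h9 hv

lemma exists_column {T : Filling} (hT : IsTableau T) (h : ∀ s ∈ T, s.length = 1) :
    ∃ col : List ℕ, col.Pairwise (· < ·) ∧ T = col.map (fun y => [y]) := by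
  obtain ⟨col, rfl⟩ : ∃ col : List ℕ, T = col.map (fun y => [y]) := by
    clear hT
    induction T with
    | nil => exact ⟨[], rfl⟩
    | cons s T ih =>
      rw [List.forall_mem_cons] at h
      obtain ⟨y, rfl⟩ := List.length_eq_one_iff.1 h.1
      obtain ⟨col, rfl⟩ := ih h.2
      exact ⟨y :: col, rfl⟩
  refine ⟨col, ?_, rfl⟩
  have h1 := hT.2
  rw [List.isChain_map] at h1
  exact List.isChain_iff_pairwise.1 (h1.imp fun a b hab => by simpa using hab.2)

lemma isHookFilling_of_isHook {T : Filling} (hT : IsTableau T) (h : IsHook (shape T)) :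
    IsHookFilling T := by
  obtain ⟨m, r, -, h⟩ := h
  cases T with
  | nil => simp [shape] at h
  | cons row T =>
    rw [isTableau_cons] at hT
    simp only [shape, List.map_cons, List.cons.injEq] at h
    obtain ⟨col, h1, rfl⟩ := exists_column hT.2.2 fun s hs => by
      have : s.length ∈ T.map List.length := List.mem_map_of_mem hs
      rw [h.2] at this
      exact List.eq_of_mem_replicate this
    exact Or.inr ⟨row, col, hT.1.1, hT.1.2.1, h1, rfl⟩

lemma foldl_bind_none {α β : Type*} (f : β → α → Option α) (l : List β) :
    l.foldl (fun o b => o.bind (f b)) none = none := by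
  induction l with
  | nil => rfl
  | cons b l ih => exact ih

/-- What remains is the tail of the bottom row followed by the column read downwards, an increasing
word followed by a decreasing one. Working with `IsHookFilling` avoids having to show that insertion
produces a tableau. -/
lemma katabolism_row_hook (a : ℕ) {T U : Filling} (hT : IsHookFilling T)
    (h : restrictedKatabolism [a] T = some U) : IsHookFilling U := by
  rw [restrictedKatabolism] at h
  split_ifs at h with hc
  rw [katabolism, if_pos hc.1, Option.some.injEq] at h
  subst h
  rcases hT with rfl | ⟨row, col, h1, h2, h3, rfl⟩
  · exact Or.inl rfl
  · have h4 : word (col.map (fun y => [y])) = col.reverse := by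
      rw [word, ← List.map_reverse]
      induction col.reverse <;> simp_all
    simp only [List.zipWith_cons_cons, List.zipWith_nil_right, List.length_singleton,
      List.drop_succ_cons, List.drop_zero, h4]
    rw [show word [row.drop a] = row.drop a by simp [word]]
    exact rsTableau_hook (h2.sublist (List.drop_sublist _ _)) (List.pairwise_reverse.2 h3)

lemma isGeneralizedHook_of_passes (k : ℕ) (lam : List ℕ) (hlam : IsPartition lam)
    (hk : ∀ p ∈ lam, p ≤ k) (hne : lam ≠ []) (T : Filling) (hT : IsHookFilling T)
    (hp : Passes (kSplit k lam) T) : IsGeneralizedHook k lam := by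
  induction lam using kSplit.induct (k := k) generalizing T with
  | case1 => exact absurd rfl hne
  | case2 a l ih =>
    rw [kSplit, Passes, List.foldl_cons, Option.bind_some] at hp
    rw [isPartition_cons] at hlam
    rw [List.forall_mem_cons] at hk
    rcases h : restrictedKatabolism (a :: l.take (k - a)) T with _ | U
    · rw [h, foldl_bind_none] at hp
      exact absurd hp (by simp)
    rw [h] at hp
    cases l with
    | nil => exact ⟨0, [a], ⟨a, 0, hlam.2.1, rfl⟩, rfl⟩
    | cons c l =>
      -- Since `a ≤ k`, a zero difference means `a = k`: the first block is a single row, and the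
      -- induction prepends one part `k`.
      rcases Nat.eq_zero_or_pos (k - a) with h0 | h0
      · obtain rfl : a = k := by omega
        rw [h0, List.take_zero] at h
        rw [h0, List.drop_zero] at hp ih
        obtain ⟨n, rho, h1, h2⟩ := ih hlam.2.2 hk.2 (by simp) U (katabolism_row_hook a hT h) hp
        exact ⟨n + 1, rho, h1, by rw [h2, List.replicate_succ]; rfl⟩
      · rw [restrictedKatabolism] at h
        split_ifs at h with hc
        obtain ⟨d, hd⟩ : ∃ d, k - a = d + 1 := ⟨k - a - 1, by omega⟩
        -- Containment is tested in the second row, where the hook has length at most 1; so `c ≤ 1`,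
        -- and all later parts equal 1.
        have h1 := hc.1 1 (by simp [hd])
        rw [hd] at h1
        simp only [List.take_succ_cons, List.getD_cons_succ, List.getD_cons_zero] at h1
        have h2 : (shape T).getD 1 0 ≤ 1 := by
          rcases hT with rfl | ⟨row, col, -, -, -, rfl⟩
          · simp [shape]
          · cases col <;> simp [shape]
        refine ⟨0, _, ⟨a, (c :: l).length, hlam.2.1, ?_⟩, rfl⟩
        congr 1
        refine List.eq_replicate_iff.2 ⟨rfl, fun y hy => ?_⟩
        have h3 := hlam.2.2.2 y hy
        have h4 : y ≤ c := by
          rcases List.mem_cons.1 hy with rfl | hy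
          · exact le_rfl
          · exact (isPartition_cons.1 hlam.2.2).1 y hy
        omega

lemma not_isHook_of_mem_superAtom {k : ℕ} {lam : List ℕ} (hlam : IsPartition lam)
    (hk : ∀ p ∈ lam, p ≤ k) (hgen : ¬ IsGeneralizedHook k lam) {T : Filling}
    (hT : T ∈ superAtom k lam) : ¬ IsHook (shape T) := by
  intro h
  have h1 := isHookFilling_of_isHook (superAtom_spec k hlam T hT).1 h
  cases lam with
  | nil =>
    simp only [superAtom, Finset.mem_singleton] at hT
    obtain ⟨m, r, -, h⟩ := h
    simp [hT, shape] at h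
  | cons a l =>
    exact hgen (isGeneralizedHook_of_passes k _ hlam hk (by simp) T h1 (mem_superAtom_cons.1 hT).2)

/-! ### Linear independence of the Schur functions -/

/-- The exponent with entries `mu`. -/
noncomputable def contentExponent (mu : List ℕ) : ℕ →₀ ℕ :=
  Finsupp.onFinset (Finset.range mu.length) (fun i => mu.getD i 0) fun i hi => by
    rw [Finset.mem_range]
    by_contra! h
    exact hi (List.getD_eq_default _ _ h)

lemma eq_of_sum_take_eq {mu nu : List ℕ} (hmu : IsPartition mu) (hnu : IsPartition nu)
    (h : ∀ i, (mu.take i).sum = (nu.take i).sum) : mu = nu := by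
  have h1 : ∀ i, mu.getD i 0 = nu.getD i 0 := fun i => by
    have h2 := h (i + 1)
    rw [sum_take_succ_getD, sum_take_succ_getD, h i] at h2
    omega
  have hlen : ∀ {mu nu : List ℕ}, IsPartition mu → (∀ i, mu.getD i 0 = nu.getD i 0) →
      mu.length ≤ nu.length := by
    intro mu nu hmu h1
    by_contra! hc
    have h2 := h1 nu.length
    rw [List.getD_eq_default nu _ le_rfl, List.getD_eq_getElem _ _ hc] at h2
    exact (hmu.2 _ (List.getElem_mem hc)).ne' h2
  refine List.ext_getElem (le_antisymm (hlen hmu h1) (hlen hnu fun i => (h1 i).symm)) ?_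
  intro i h2 h3
  have := h1 i
  rwa [List.getD_eq_getElem _ _ h2, List.getD_eq_getElem _ _ h3] at this

/-- A nonzero `Nat.card` provides a tableau, whose content is dominated by its shape. Finiteness of
the set of tableaux need not be proved separately. -/
lemma sum_take_le_of_coeff_schur_ne_zero {mu nu : List ℕ}
    (h : MvPowerSeries.coeff (contentExponent mu) (schur nu) ≠ 0) (i : ℕ) :
    (mu.take i).sum ≤ (nu.take i).sum := by
  have h1 : Nat.card {T : Filling // IsTableau T ∧ shape T = nu ∧
    ∀ i, (word T).count (i + 1) = contentExponent mu i} ≠ 0 := fun h0 => h (by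
      change ((Nat.card _ : ℕ) : Kqt) = 0
      rw [h0, Nat.cast_zero])
  obtain ⟨T, hT, rfl, hc⟩ := (Nat.card_ne_zero.1 h1).1
  exact HasContent.dominance hT hc i

lemma coeff_schur_self {mu : List ℕ} (hmu : IsPartition mu) :
    MvPowerSeries.coeff (contentExponent mu) (schur mu) = 1 := by
  change ((Nat.card {T : Filling // IsTableau T ∧ shape T = mu ∧
    ∀ i, (word T).count (i + 1) = contentExponent mu i} : ℕ) : Kqt) = 1
  rw [Nat.card_eq_one_iff_unique.2, Nat.cast_one]
  refine ⟨⟨?_⟩, ⟨superstandard 0 mu, isTableau_superstandard 0 hmu, shape_superstandard 0 mu,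
    hasContent_superstandard mu⟩⟩
  have h : ∀ T : Filling, IsTableau T → shape T = mu → HasContent T mu →
      T = superstandard 0 mu := by
    rintro T hT rfl hc
    exact hc.eq_superstandard hT
  rintro ⟨T, h1, h2, h3⟩ ⟨U, h4, h5, h6⟩
  exact Subtype.ext ((h T h1 h2 h3).trans (h U h4 h5 h6).symm)

lemma linearIndependent_schur : LinearIndependent Kqt (fun mu : Ptn => schur mu.1) := by
  rw [linearIndependent_iff]
  intro c hc
  by_contra hne
  -- Partial sums compared pointwise extend dominance to partitions of different integers. For a
  -- maximal `mu` in the support, no other Schur function of the combination contains the monomial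
  -- with exponent `mu`.
  obtain ⟨mu, hmu, hmax⟩ := Finset.exists_maximalFor
    (fun (mu : Ptn) (i : ℕ) => (mu.1.take i).sum) c.support (Finsupp.support_nonempty_iff.2 hne)
  have h1 := congrArg (MvPowerSeries.coeff (contentExponent mu.1)) hc
  rw [Finsupp.linearCombination_apply, map_finsuppSum, map_zero, Finsupp.sum,
    Finset.sum_eq_single mu] at h1
  · rw [map_smul, coeff_schur_self mu.2, smul_eq_mul, mul_one] at h1
    exact Finsupp.mem_support_iff.1 hmu h1
  · intro nu hnu hne
    rw [map_smul, smul_eq_mul]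
    by_contra h2
    have h3 := sum_take_le_of_coeff_schur_ne_zero (right_ne_zero_of_mul h2)
    have h4 := hmax hnu h3
    exact hne (Subtype.ext (eq_of_sum_take_eq nu.2 mu.2 fun i => le_antisymm (h4 i) (h3 i)))
  · exact fun h => absurd hmu h

/-! ### The Schur expansion of an atom -/

open Classical in
/-- The shape of a tableau, as a partition. -/
noncomputable def shapePtn (T : Filling) : Ptn :=
  if h : IsTableau T then ⟨shape T, isPartition_shape h⟩ else ⟨[], by simp [IsPartition]⟩

lemma coe_shapePtn {T : Filling} (h : IsTableau T) : (shapePtn T).1 = shape T := by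
  rw [shapePtn, dif_pos h]

/-- Only this direction is needed, so possible cancellation in `R` does not matter. It serves both
for `ℕ[X]` and for `ℚ(q,t)`. -/
lemma exists_of_sum_single_ne_zero {R : Type*} [AddCommMonoid R] {s : Finset Filling}
    {f : Filling → R} {mu : Ptn}
    (h : (∑ T ∈ s, Finsupp.single (shapePtn T) (f T)) mu ≠ 0) : ∃ T ∈ s, shapePtn T = mu := by
  rw [Finsupp.finsetSum_apply] at h
  obtain ⟨T, hT, h1⟩ := Finset.exists_ne_zero_of_sum_ne_zero h
  exact ⟨T, hT, (Finsupp.single_apply_ne_zero.1 h1).1.symm⟩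

lemma atom_eq_linearCombination (k : ℕ) {lam : List ℕ} (hlam : IsPartition lam) :
    atom k lam = Finsupp.linearCombination Kqt (fun mu : Ptn => schur mu.1)
      (∑ T ∈ superAtom k lam, Finsupp.single (shapePtn T) (tvar ^ charge (word T))) := by
  rw [atom, map_sum]
  refine Finset.sum_congr rfl fun T hT => ?_
  rw [Finsupp.linearCombination_single, coe_shapePtn (superAtom_spec k hlam T hT).1]

/-- The coefficients of the Schur expansion of an atom apart from its leading term. -/
noncomputable def atomCoeff (k : ℕ) (lam : List ℕ) : Ptn →₀ ℕ[X] :=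
  ∑ T ∈ (superAtom k lam).erase (superstandard 0 lam),
    Finsupp.single (shapePtn T) (Polynomial.X ^ charge (word T))

lemma atom_eq (k : ℕ) {lam : List ℕ} (hlam : IsPartition lam) :
    atom k lam = schur lam + (atomCoeff k lam).sum
      (fun mu p => p.eval₂ (Nat.castRingHom Kqt) tvar • schur mu.1) := by
  rw [atom, ← Finset.add_sum_erase _ _ (superstandard_mem_superAtom k hlam),
    charge_superstandard hlam, pow_zero, one_smul, shape_superstandard, atomCoeff,
    ← Finsupp.sum_finsetSum_index (fun _ => by rw [Polynomial.eval₂_zero, zero_smul])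
      (fun _ _ _ => by rw [Polynomial.eval₂_add, add_smul])]
  congr 1
  refine Finset.sum_congr rfl fun T hT => ?_
  rw [Finsupp.sum_single_index (by rw [Polynomial.eval₂_zero, zero_smul]),
    Polynomial.eval₂_X_pow, coe_shapePtn (superAtom_spec k hlam T (Finset.mem_of_mem_erase hT)).1]

lemma dominanceLT_of_mem_superAtom {k : ℕ} {lam : List ℕ} (hlam : IsPartition lam) {T : Filling}
    (hT : T ∈ superAtom k lam) (hne : T ≠ superstandard 0 lam) : DominanceLT lam (shape T) := by
  obtain ⟨h1, h2⟩ := superAtom_spec k hlam T hT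
  refine ⟨h2.sum_eq h1, h2.dominance h1, fun h => hne ?_⟩
  subst h
  exact h2.eq_superstandard h1

end TableauAtoms

theorem mainTheorem6 (k : ℕ) (lam : List ℕ) (hlam : IsPartition lam)
    (hk : ∀ p ∈ lam, p ≤ k) (hgen : ¬ IsGeneralizedHook k lam) :
    (∀ (C : Set Filling) (T : Filling), IsCopy k C T → shape T = lam →
      ∀ U ∈ C, ¬ IsHook (shape U)) ∧
    (∃ v : Ptn →₀ ℕ[X],
      (∀ mu ∈ v.support, DominanceLT lam mu.1) ∧
      atom k lam = schur lam +
        v.sum (fun mu p => p.eval₂ (Nat.castRingHom Kqt) tvar • schur mu.1) ∧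
      ∀ mu : Ptn, IsHook mu.1 → v mu = 0) ∧
    (∀ c : Ptn →₀ Kqt, atom k lam = c.sum (fun mu a => a • schur mu.1) →
      ∀ mu : Ptn, IsHook mu.1 → c mu = 0) := by
  refine ⟨?_, ⟨atomCoeff k lam, ?_, atom_eq k hlam, ?_⟩, ?_⟩
  -- The shape-preserving bijection `e` transfers the claim to the super atom itself.
  · rintro C T ⟨-, -, e, he, -⟩ rfl U hU
    have h := he ⟨U, hU⟩
    rw [← h]
    exact not_isHook_of_mem_superAtom hlam hk hgen (e ⟨U, hU⟩).2
  · intro mu hmu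
    obtain ⟨T, hT, rfl⟩ := exists_of_sum_single_ne_zero (Finsupp.mem_support_iff.1 hmu)
    obtain ⟨h1, h2⟩ := Finset.mem_erase.1 hT
    rw [coe_shapePtn (superAtom_spec k hlam T h2).1]
    exact dominanceLT_of_mem_superAtom hlam h2 h1
  · intro mu hmu
    by_contra h
    obtain ⟨T, hT, rfl⟩ := exists_of_sum_single_ne_zero h
    have h1 := Finset.mem_of_mem_erase hT
    rw [coe_shapePtn (superAtom_spec k hlam T h1).1] at hmu
    exact not_isHook_of_mem_superAtom hlam hk hgen h1 hmu
  · intro c hc mu hmu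
    rw [atom_eq_linearCombination k hlam, ← Finsupp.linearCombination_apply] at hc
    -- Any finite expansion is the one read off from the super atom, so a nonzero coefficient comes
    -- from a member of that shape.
    have h1 := linearIndependent_schur hc
    by_contra h
    rw [← h1] at h
    obtain ⟨T, hT, rfl⟩ := exists_of_sum_single_ne_zero h
    rw [coe_shapePtn (superAtom_spec k hlam T hT).1] at hmu
    exact not_isHook_of_mem_superAtom hlam hk hgen hT hmu
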